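/- **Corollary 3.3 (Concentration of the bulk).** Let $0<y\le 1$ and $\varepsilon>0$, and put $a=(1-\sqrt y)^2$, $b=(1+\sqrt y)^2$. There is $\varepsilon'>0$, depending only on $y$ and $\varepsilon$, for which the following holds. For each $n$ let $p=p(n)\le n$ be an integer, with $p/n\to y$ as $n\to\infty$, and let $M=(\zeta_{ij})_{1\le i\le p,\,1\le j\le n}$ be a random complex $p\times n$ matrix (whose distribution may depend on $n$). Assume that: - the entries $\zeta_{ij}$ are jointly independent, with mean zero and variance $1$, and $\sup_{i,j}\mathbf E|\zeta_{ij}|^{C_0}\le C$ for some $C_0\ge 2$ and some $C$, both independent of $n$; - $|\zeta_{ij}|\le K$ almost surely for all $i,j$, for some $K=K(n)>1$ which may depend on $n$; if $C_0=2$, assume in addition that $K^2\log^{20}n=O(n)$; - the distribution of $M$ is continuous, i.e. $\mathbf P(M=A)=0$ for every fixed matrix $A$ (whenever $p\geq 1$). Let $W=\frac1n M^*M$, and let $0\le\lambda_1(W)\le\dots\le\lambda_p(W)$ be its eigenvalues, counted with multiplicity, after the first $n-p$ eigenvalues in increasing order (which are zero) are discarded. Then with overwhelming probability $$a+\varepsilon'\le\lambda_i(W)\le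 b-\varepsilon'\qquad\text{for all } i \text{ with } \varepsilon p\le i\le(1-\varepsilon)p .$$ That is, for every constant $A>0$ this event has probability at least $1-O_A(n^{-A})$ as $n\to\infty$. -/

import Mathlib

open MeasureTheory ProbabilityTheory Filter Asymptotics
open scoped Matrix

noncomputable section

/-- The `n × n` covariance matrix `W = (1/n) M* M` of a `p × n` matrix `M`. -/
def covarianceMatrix {p n : ℕ} (M : Matrix (Fin p) (Fin n) ℂ) : Matrix (Fin n) (Fin n) ℂ :=
  ((n : ℝ)⁻¹) • (Mᴴ * M)

theorem covarianceMatrix_isHermitian {p n : ℕ} (M : Matrix (Fin p) (Fin n) ℂ) :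
    (covarianceMatrix M).IsHermitian := by
  unfold covarianceMatrix Matrix.IsHermitian
  rw [Matrix.conjTranspose_smul, (Matrix.isHermitian_conjTranspose_mul_self M).eq]
  simp

/-- For `p ≤ n`, the nontrivial eigenvalues `λ₁(W) ≤ … ≤ λ_p(W)` of the covariance matrix `W` of `M`,
counted with multiplicity: the `n` eigenvalues of `W` in increasing order, the first `n - p` of
them (which vanish) discarded. The index is zero-based: `covEigenvalue h M i` is `λ_{i+1}(W)`.
(`eigenvalues₀` lists all eigenvalues in decreasing order, so `λ_p` is its entry `0`.) -/
def covEigenvalue {p n : ℕ} (h : p ≤ n) (M : Matrix (Fin p) (Fin n) ℂ) (i : Fin p) : ℝ :=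
  (covarianceMatrix_isHermitian M).eigenvalues₀
    (Fin.castLE (h.trans_eq (Fintype.card_fin n).symm) i.rev)

/-- Condition C1 with exponent `C₀ ≥ 2` for an ensemble of random `p(n) × n` matrices: the entries
are jointly independent random variables of mean zero and variance one, and their absolute moments
of order `C₀` are bounded by a constant independent of `n` (and of the entry). -/
def ConditionC1 {Ω : ℕ → Type*} [∀ n, MeasurableSpace (Ω n)] (μ : ∀ n, Measure (Ω n)) {p : ℕ → ℕ}
    (M : ∀ n, Ω n → Matrix (Fin (p n)) (Fin n) ℂ) (C₀ : ℝ) : Prop :=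
  2 ≤ C₀ ∧
  (∀ n i j, Measurable fun ω => M n ω i j) ∧
  (∀ n, iIndepFun (fun (ij : Fin (p n) × Fin n) (ω : Ω n) => M n ω ij.1 ij.2) (μ n)) ∧
  (∀ n i j, ∫ ω, M n ω i j ∂(μ n) = 0) ∧
  (∀ n i j, ∫ ω, ‖M n ω i j‖ ^ 2 ∂(μ n) = 1) ∧
  ∃ C : ℝ, ∀ n i j, Integrable (fun ω => ‖M n ω i j‖ ^ C₀) (μ n) ∧
    ∫ ω, ‖M n ω i j‖ ^ C₀ ∂(μ n) ≤ C

/-- The law of the random matrix is continuous: no single matrix has positive probability.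
A matrix without entries has only one value and is exempt. -/
def ContinuousLaw {Ω : ℕ → Type*} [∀ n, MeasurableSpace (Ω n)] (μ : ∀ n, Measure (Ω n)) {p : ℕ → ℕ}
    (M : ∀ n, Ω n → Matrix (Fin (p n)) (Fin n) ℂ) : Prop :=
  ∀ n, 0 < p n → ∀ A : Matrix (Fin (p n)) (Fin n) ℂ, μ n {ω | M n ω = A} = 0

/-- The events `E n` hold with overwhelming probability: for every `A > 0`,
`P(E n) ≥ 1 - O_A(n^{-A})`. -/
def WithOverwhelmingProbability {Ω : ℕ → Type*} [∀ n, MeasurableSpace (Ω n)]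
    (μ : ∀ n, Measure (Ω n)) (E : ∀ n, Set (Ω n)) : Prop :=
  ∀ A : ℝ, 0 < A → ∃ B : ℝ, ∀ᶠ n : ℕ in atTop, 1 - B * (n : ℝ) ^ (-A) ≤ (μ n).real (E n)

end

/-! The limiting spectral law of the n × n matrix W is (1-y)δ₀ plus y times the Marchenko–Pastur
law, and its Stieltjes transform solves z m² + (z+1-y) m + 1 = 0. Bulk eigenvalues are confined once
few of the n eigenvalues exceed b - ε' and not many more than (1-y)n lie below a + ε'. Both are
upper bounds on mass, so neither the density nor a local law is needed: approximate validity of the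
equation at finitely many fixed z suffices.

Deterministic half (`MassBound`). At height r, Im m controls the mass of a window of radius r. Where
the discriminant (x-a)(x-b) is positive, both roots are nearly real (`im_le_of_mpDefect`);
approximate solutions stay bounded near a positive point, so no mass concentrates there
(`massBound_point`); the mass near 0 is at most about 1-y (`massBound_zero`); little mass escapes to
infinity (`massBound_tail`). Glued together, these give `massBound_lower` and `massBound_upper`.

Random half. Sherman–Morrison writes the defect in the equation as an average of the differences
between the quadratic form of each row in the resolvent of the other rows and m
(`norm_mpDefect_gramStieltjes_le`). Row and resolvent are independent, so the form is close in mean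
to its normalised trace, given a Lindeberg condition on the entries (`eventually_tailMoment_le`).
Hence the mean defect is small. Replacing one row moves m by O(1/n), so bounded differences make the
failure probability at each z exponentially small, and a union bound over the finitely many z
finishes. -/

/-! ### Stieltjes transforms of finite families of reals -/

/-- The Stieltjes transform of the empirical measure of a finite family of reals. -/
noncomputable def empStieltjes {n : ℕ} (l : Fin n → ℝ) (z : ℂ) : ℂ :=
  (n : ℂ)⁻¹ * ∑ i, ((l i : ℂ) - z)⁻¹

/-- The defect of `m` in the Marchenko–Pastur equation with ratio `y` at `z`. -/
def mpDefect (y : ℝ) (z m : ℂ) : ℂ := z * m ^ 2 + (z + 1 - y) * m + 1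

theorem inv_ofReal_sub_im (l : ℝ) (z : ℂ) :
    (((l : ℂ) - z)⁻¹).im = z.im / ((l - z.re) ^ 2 + z.im ^ 2) := by
  simp [Complex.inv_im, Complex.normSq_apply, pow_two]

theorem empStieltjes_im {n : ℕ} (l : Fin n → ℝ) (z : ℂ) :
    (empStieltjes l z).im = (n : ℝ)⁻¹ * ∑ i, z.im / ((l i - z.re) ^ 2 + z.im ^ 2) := by
  have : empStieltjes l z = ((n : ℝ)⁻¹ : ℝ) * ∑ i, ((l i : ℂ) - z)⁻¹ := by
    simp [empStieltjes]
  rw [this, Complex.im_ofReal_mul, Complex.im_sum]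
  simp_rw [inv_ofReal_sub_im]

theorem empStieltjes_im_nonneg {n : ℕ} (l : Fin n → ℝ) {z : ℂ} (hz : 0 < z.im) :
    0 ≤ (empStieltjes l z).im := by
  rw [empStieltjes_im]; positivity

theorem norm_empStieltjes_le {n : ℕ} (l : Fin n → ℝ) {z : ℂ} (hz : 0 < z.im) :
    ‖empStieltjes l z‖ ≤ z.im⁻¹ := by
  have h : ∀ i, ‖((l i : ℂ) - z)⁻¹‖ ≤ z.im⁻¹ := fun i => by
    rw [norm_inv]
    refine inv_anti₀ hz ?_
    have := Complex.abs_im_le_norm ((l i : ℂ) - z)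
    simpa [abs_of_pos hz] using this
  rw [empStieltjes, norm_mul]
  rcases Nat.eq_zero_or_pos n with rfl | hn
  · simp [hz.le]
  have hn' : (0 : ℝ) < n := by exact_mod_cast hn
  calc ‖(n : ℂ)⁻¹‖ * ‖∑ i, ((l i : ℂ) - z)⁻¹‖ ≤ (n : ℝ)⁻¹ * ∑ _i : Fin n, z.im⁻¹ := by
        gcongr
        · simp
        · exact norm_sum_le_of_le _ fun i _ => h i
    _ = z.im⁻¹ := by simp; field_simp

/-! ### Mass bounds from finitely many test points -/

/-- `MassBound y S d`: closeness of the Stieltjes transform to a solution of the Marchenko–Pastur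
equation at finitely many points forces the proportion of the (nonnegative) atoms lying in `S`
to be at most `d`. -/
def MassBound (y : ℝ) (S : Set ℝ) (d : ℝ) : Prop :=
  ∃ Z : Finset (ℂ × ℝ), (∀ q ∈ Z, 0 < q.1.im ∧ 0 < q.2) ∧
    ∀ (n : ℕ) (l : Fin n → ℝ), 0 < n → (∀ i, 0 ≤ l i) →
      (∀ q ∈ Z, ‖mpDefect y q.1 (empStieltjes l q.1)‖ ≤ q.2) →
        ∀ s : Finset (Fin n), (∀ i ∈ s, l i ∈ S) → (s.card : ℝ) ≤ d * n

theorem MassBound.mono {y : ℝ} {S T : Set ℝ} {d e : ℝ} (h : MassBound y T e)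
    (hST : ∀ x ∈ S, 0 ≤ x → x ∈ T) (hde : e ≤ d) : MassBound y S d := by
  obtain ⟨Z, hZ, h⟩ := h
  exact ⟨Z, hZ, fun n l hn hl hq s hs =>
    (h n l hn hl hq s fun i hi => hST _ (hs i hi) (hl i)).trans (by gcongr)⟩

theorem MassBound.union {y : ℝ} {S T : Set ℝ} {d e : ℝ} (hS : MassBound y S d)
    (hT : MassBound y T e) : MassBound y (S ∪ T) (d + e) := by
  classical
  obtain ⟨Z, hZ, h⟩ := hS
  obtain ⟨Z', hZ', h'⟩ := hT
  refine ⟨Z ∪ Z', fun q hq => (Finset.mem_union.1 hq).elim (hZ q) (hZ' q),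
    fun n l hn hl hq s hs => ?_⟩
  have h1 := h n l hn hl (fun q hq' => hq q (Finset.mem_union_left _ hq'))
    (s.filter fun i => l i ∈ S) (by simp)
  have h2 := h' n l hn hl (fun q hq' => hq q (Finset.mem_union_right _ hq'))
    (s.filter fun i => l i ∉ S) (fun i hi => by
      have := Finset.mem_filter.1 hi
      exact (hs i this.1).resolve_left this.2)
  have : (s.card : ℝ)
      = (s.filter fun i => l i ∈ S).card + (s.filter fun i => l i ∉ S).card := by
    exact_mod_cast (Finset.card_filter_add_card_filter_not _).symm
  linarith

theorem massBound_empty (y : ℝ) : MassBound y ∅ 0 :=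
  ⟨∅, by simp, fun n l _ _ _ s hs => by
    simp [Finset.eq_empty_of_forall_notMem (s := s) (by simpa using hs)]⟩

theorem MassBound.biUnion {y d : ℝ} (S : ℕ → Set ℝ) (J : ℕ) (h : ∀ j < J, MassBound y (S j) d) :
    MassBound y (⋃ j < J, S j) (J * d) := by
  induction J with
  | zero => simpa using massBound_empty y
  | succ J ih =>
    have := (ih fun j hj => h j (by omega)).union (h J (by omega))
    refine this.mono (fun x hx _ => ?_) (by push_cast; linarith)
    simp only [Set.mem_iUnion, Set.mem_union] at hx ⊢
    obtain ⟨j, hj, hx⟩ := hx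
    rcases Nat.lt_succ_iff_lt_or_eq.1 hj with hj | rfl
    · exact .inl ⟨j, hj, hx⟩
    · exact .inr hx

/-- Markov-type count: atoms at which the Poisson kernel is at least `c`. -/
theorem card_mul_le_empStieltjes_im {n : ℕ} (l : Fin n → ℝ) (hn : 0 < n) {z : ℂ} (hz : 0 < z.im)
    (s : Finset (Fin n)) {c : ℝ} (hs : ∀ i ∈ s, c ≤ z.im / ((l i - z.re) ^ 2 + z.im ^ 2)) :
    c * s.card ≤ n * (empStieltjes l z).im := by
  have hn' : (0 : ℝ) < n := by exact_mod_cast hn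
  rw [empStieltjes_im, mul_inv_cancel_left₀ hn'.ne']
  calc c * s.card = ∑ _i ∈ s, c := by simp [mul_comm]
    _ ≤ ∑ i ∈ s, z.im / ((l i - z.re) ^ 2 + z.im ^ 2) := Finset.sum_le_sum hs
    _ ≤ _ := Finset.sum_le_sum_of_subset_of_nonneg (Finset.subset_univ _)
        fun i _ _ => by positivity

/-- On the window of radius r, the Poisson kernel at height r is at least 1/(2r), so the proportion
of atoms there is at most 2r · Im m. A single test point above the centre is enough. -/
theorem massBound_window {y x r d κ : ℝ} (hr : 0 < r) (hκ : 0 < κ)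
    (h : ∀ m : ℂ, 0 ≤ m.im → ‖mpDefect y ⟨x, r⟩ m‖ ≤ κ → 2 * r * m.im ≤ d) :
    MassBound y (Set.Icc (x - r) (x + r)) d := by
  classical
  refine ⟨{(⟨x, r⟩, κ)}, by simp [hr, hκ], fun n l hn hl hq s hs => ?_⟩
  have hq' := hq (⟨x, r⟩, κ) (by simp)
  have h1 := h _ (empStieltjes_im_nonneg l (z := ⟨x, r⟩) hr) hq'
  have h2 := card_mul_le_empStieltjes_im l hn (z := ⟨x, r⟩) hr
    s (c := 1 / (2 * r)) (by
      intro i hi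
      replace hi := hs i hi
      rw [Set.mem_Icc] at hi
      simp only
      rw [div_le_div_iff₀ (by positivity) (by positivity)]
      nlinarith [mul_nonneg (sub_nonneg.2 hi.1) (sub_nonneg.2 hi.2)])
  have hn' : (0 : ℝ) < n := by exact_mod_cast hn
  have h3 : (s.card : ℝ)
      ≤ 2 * r * (n * (empStieltjes l ⟨x, r⟩).im) := by
    rw [div_mul_eq_mul_div, one_mul, div_le_iff₀ (by positivity)] at h2
    linarith
  nlinarith

/-- Away from z = 0 the quadratic has a non-degenerate leading term: z m² dominates for large m, so
approximate solutions obey |m| ≤ 1 + 3/x at every height r. Thus 2r · Im m tends to 0 with r, which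
excludes an atom at x, in particular at the edges a and b. -/
theorem massBound_point {y x : ℝ} (hy0 : 0 ≤ y) (hy1 : y ≤ 1) (hx : 0 < x) {d : ℝ} (hd : 0 < d) :
    ∃ r₀ : ℝ, 0 < r₀ ∧ ∀ r, 0 < r → r ≤ r₀ → MassBound y (Set.Icc (x - r) (x + r)) d := by
  refine ⟨d / (2 * (1 + 3 / x)), by positivity, fun r hr hr' => ?_⟩
  refine massBound_window hr one_pos fun m hm h => ?_
  rw [le_div_iff₀ (by positivity)] at hr'
  suffices m.im ≤ 1 + 3 / x by nlinarith
  refine le_trans ((le_abs_self _).trans (Complex.abs_im_le_norm m)) ?_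
  by_contra! hcon
  set z : ℂ := ⟨x, r⟩ with hz
  have hzx : x ≤ ‖z‖ := (le_abs_self _).trans (Complex.abs_re_le_norm z)
  have hm1 : 1 ≤ ‖m‖ := by
    have : 0 < 3 / x := by positivity
    linarith
  have hy' : ‖(1 - y : ℂ)‖ ≤ 1 := by
    have : (1 - y : ℂ) = ((1 - y : ℝ) : ℂ) := by push_cast; rfl
    rw [this, Complex.norm_real, Real.norm_eq_abs, abs_le]; constructor <;> linarith
  have e : z * m ^ 2 = mpDefect y z m - z * m - (1 - y) * m - 1 := by
    unfold mpDefect; ring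
  have h1 : ‖z‖ * ‖m‖ ^ 2 ≤ 1 + ‖z‖ * ‖m‖ + 1 * ‖m‖ + 1 := by
    rw [← norm_pow, ← norm_mul, e]
    refine (norm_sub_le _ _).trans ?_
    refine (add_le_add_left (norm_sub_le _ _) _).trans ?_
    refine (add_le_add_left (add_le_add_left (norm_sub_le _ _) _) _).trans ?_
    rw [norm_mul, norm_mul, norm_one]
    gcongr
  have h2 : ‖z‖ * ‖m‖ ≤ ‖z‖ + 3 := by
    by_contra! h3
    nlinarith
  have h3 : x * (‖m‖ - 1) ≤ 3 := by nlinarith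
  have : 3 < x * (‖m‖ - 1) := by
    have := mul_lt_mul_of_pos_left hcon hx
    rw [mul_add, mul_div_cancel₀ _ hx.ne'] at this
    linarith
  linarith

/-- With u = -z m and z = ir, the equation reads u (u - (1-y)) = O(r), so u is near 0 or near 1-y;
in either case Re u = r · Im m, which dominates the mass near 0, is at most about 1-y. -/
theorem massBound_zero {y : ℝ} (hy1 : y ≤ 1) {d : ℝ} (hd : 0 < d) (hy0 : 0 ≤ y) :
    ∃ r : ℝ, 0 < r ∧ MassBound y (Set.Iic r) (1 - y + d) := by
  classical
  obtain ⟨t, ht0, ht1, htd⟩ : ∃ t : ℝ, 0 < t ∧ t ≤ 1 ∧ 3 * t ≤ d :=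
    ⟨min 1 (d / 3), by positivity, min_le_left _ _, by linarith [min_le_right 1 (d / 3)]⟩
  obtain ⟨r, hr⟩ : ∃ r : ℝ, 3 * r = t ^ 2 := ⟨t ^ 2 / 3, by ring⟩
  have hr0 : 0 < r := by nlinarith
  -- The window radius r² is much smaller than the height r, so r times the Poisson kernel is at
  -- least 1/(1+r²) on it, losing almost nothing; a window of radius r would lose a factor 2.
  refine ⟨r ^ 2, by positivity, {(⟨0, r⟩, 1)}, by simp [hr0], fun n l hn hl hq s hs => ?_⟩
  have hq' := hq (⟨0, r⟩, 1) (by simp)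
  simp only at hq'
  set z : ℂ := ⟨0, r⟩ with hz
  set m := empStieltjes l z with hm
  have hn' : (0 : ℝ) < n := by exact_mod_cast hn
  have hzn : ‖z‖ = r := by
    have : z = r * Complex.I := by apply Complex.ext <;> simp [hz]
    rw [this]; simp [abs_of_pos hr0]
  have hu1 : ‖z * m‖ ≤ 1 := by
    rw [norm_mul, hzn]
    have := norm_empStieltjes_le l (z := z) hr0
    calc r * ‖m‖ ≤ r * r⁻¹ := by gcongr
      _ = 1 := mul_inv_cancel₀ hr0.ne'
  have e : (-(z * m)) * (-(z * m) - (1 - y)) = z * (-(z * m) - 1 + mpDefect y z m) := by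
    unfold mpDefect; ring
  have hprod : ‖-(z * m)‖ * ‖-(z * m) - (1 - y)‖ ≤ t ^ 2 := by
    rw [← norm_mul, e, norm_mul, hzn, ← hr]
    have : ‖-(z * m) - 1 + mpDefect y z m‖ ≤ 1 + 1 + 1 := by
      refine (norm_add_le _ _).trans (add_le_add ((norm_sub_le _ _).trans ?_) hq')
      rw [norm_neg, norm_one]; exact add_le_add_left hu1 1
    nlinarith
  have hg : r * m.im ≤ 1 - y + t := by
    have hre : (-(z * m)).re = r * m.im := by simp [hz]
    rcases le_or_gt ‖-(z * m)‖ t with h | h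
    · have := Complex.re_le_norm (-(z * m)); linarith
    · have h2 : ‖-(z * m) - (1 - y)‖ ≤ t := by
        by_contra! h3; nlinarith
      have := Complex.re_le_norm (-(z * m) - (1 - y))
      have h4 : (-(z * m) - (1 - y)).re = r * m.im - (1 - y) := by rw [← hre]; simp
      linarith
  have h2 := card_mul_le_empStieltjes_im l hn (z := z) hr0
    s (c := r / ((r ^ 2) ^ 2 + r ^ 2)) (by
      intro i hi
      replace hi := hs i hi
      rw [Set.mem_Iic] at hi
      have hli := hl i
      simp only [hz, sub_zero]
      gcongr)
  rw [← hm, div_mul_eq_mul_div, div_le_iff₀ (by positivity)] at h2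
  set N : ℝ := (s.card : ℝ)
  have h3 : N ≤ n * (r * m.im) * (1 + r ^ 2) := by
    have : r * N ≤ r * (n * (r * m.im) * (1 + r ^ 2)) := by linarith
    exact le_of_mul_le_mul_left this hr0
  have h4 : (r * m.im) * (1 + r ^ 2) ≤ 1 - y + d := by
    have : (r * m.im) * (1 + r ^ 2) ≤ (1 - y + t) * (1 + r ^ 2) := by gcongr
    have hrt : r ≤ t / 3 := by nlinarith
    nlinarith
  nlinarith

/-- At z = iL with L = 1/t, the trivial bound |m| ≤ t turns the equation into 1 + z m = O(t), so L ·
Im m is nearly 1. Each atom contributes at most 1 to n L · Im m, and an atom beyond L at most 1/2,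
so such atoms are rare. -/
theorem massBound_tail {y : ℝ} (hy1 : y ≤ 1) {d : ℝ} (hd : 0 < d) (hy0 : 0 ≤ y) :
    ∃ L₀ : ℝ, 0 < L₀ ∧ MassBound y (Set.Ioi L₀) d := by
  classical
  obtain ⟨t, ht0, ht1, htd⟩ : ∃ t : ℝ, 0 < t ∧ t ≤ 1 / 2 ∧ 8 * t ≤ d :=
    ⟨min (1 / 2) (d / 8), by positivity, min_le_left _ _,
      by linarith [min_le_right (1 / 2) (d / 8)]⟩
  have hL : 0 < t⁻¹ := by positivity
  refine ⟨t⁻¹, hL, {(⟨0, t⁻¹⟩, t)}, by simp [ht0], fun n l hn hl hq T hT => ?_⟩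
  have hq' := hq (⟨0, t⁻¹⟩, t) (by simp)
  simp only at hq'
  set z : ℂ := ⟨0, t⁻¹⟩ with hz
  set m := empStieltjes l z with hm
  have hn' : (0 : ℝ) < n := by exact_mod_cast hn
  have hmt : ‖m‖ ≤ t := by simpa [hz] using norm_empStieltjes_le l (z := z) hL
  have e : (1 + z * m) = mpDefect y z m + y * m - (1 + z * m) * m := by
    unfold mpDefect; ring
  have h1 : ‖1 + z * m‖ ≤ t + 1 * t + ‖1 + z * m‖ * t := by
    conv_lhs => rw [e]
    refine (norm_sub_le _ _).trans (add_le_add ((norm_add_le _ _).trans (add_le_add hq' ?_)) ?_)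
    · rw [norm_mul, Complex.norm_real, Real.norm_eq_abs, abs_of_nonneg hy0]; gcongr
    · rw [norm_mul]; gcongr
  have h2 : ‖1 + z * m‖ ≤ 4 * t := by nlinarith [norm_nonneg (1 + z * m)]
  have h3 : 1 - t⁻¹ * m.im ≤ 4 * t := by
    have := Complex.re_le_norm (1 + z * m)
    have h4 : (1 + z * m).re = 1 - t⁻¹ * m.im := by simp [hz, sub_eq_add_neg]
    linarith
  -- the complement of the tail has almost full mass
  have h5 : n * (t⁻¹ * m.im) ≤ ∑ i, if i ∈ T then (1 / 2 : ℝ) else 1 := by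
    rw [hm, empStieltjes_im]
    have : (n : ℝ) * (t⁻¹ * ((n : ℝ)⁻¹ * ∑ i, z.im / ((l i - z.re) ^ 2 + z.im ^ 2)))
        = ∑ i, t⁻¹ * (z.im / ((l i - z.re) ^ 2 + z.im ^ 2)) := by
      rw [Finset.mul_sum, Finset.mul_sum, Finset.mul_sum]
      refine Finset.sum_congr rfl fun i _ => ?_
      field_simp
    rw [this]
    refine Finset.sum_le_sum fun i _ => ?_
    simp only [hz, sub_zero]
    rw [← mul_div_assoc]
    split_ifs with hi
    · replace hi := hT i hi
      rw [Set.mem_Ioi] at hi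
      rw [div_le_div_iff₀ (by positivity) (by norm_num)]
      nlinarith
    · rw [div_le_one (by positivity)]
      nlinarith
  have h6 : ∑ i, (if i ∈ T then (1 / 2 : ℝ) else 1) = n - T.card / 2 := by
    have : ∀ i, (if i ∈ T then (1 / 2 : ℝ) else 1) = 1 - if i ∈ T then (1 / 2 : ℝ) else 0 :=
      fun i => by split_ifs <;> norm_num
    simp_rw [this, Finset.sum_sub_distrib]
    simp [Finset.sum_ite_mem]
    ring
  rw [h6] at h5
  nlinarith

/-! ### Mass outside the support and near its edges -/

/-- Off the support `[a, b]`, approximate solutions of the Marchenko–Pastur equation close to the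
real line have small imaginary part, uniformly on compact sets. -/
theorem im_le_of_mpDefect {y x₁ x₂ D δ : ℝ} (hy0 : 0 ≤ y) (hy1 : y ≤ 1) (hx₁ : 0 < x₁)
    (hlt : x₁ < x₂) (hD : 0 < D) (hδ : 0 < δ)
    (hdisc : ∀ x ∈ Set.Icc x₁ x₂, D ≤ x ^ 2 - 2 * (1 + y) * x + (1 - y) ^ 2) :
    ∃ η₀ : ℝ, 0 < η₀ ∧ ∀ η, 0 < η → η ≤ η₀ → ∃ κ : ℝ, 0 < κ ∧ ∀ x ∈ Set.Icc x₁ x₂, ∀ m : ℂ,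
      ‖mpDefect y ⟨x, η⟩ m‖ ≤ κ → m.im ≤ δ := by
  have hx₂ : 0 < x₂ := hx₁.trans hlt
  obtain ⟨C₁, hC₁⟩ : ∃ C : ℝ, C = 2 * x₂ + 5 := ⟨_, rfl⟩
  obtain ⟨C₂, hC₂⟩ : ∃ C : ℝ, C = C₁ ^ 2 / (2 * D) + 1 := ⟨_, rfl⟩
  have hC₂1 : 1 ≤ C₂ := by
    have : 0 ≤ C₁ ^ 2 / (2 * D) := by positivity
    linarith
  obtain ⟨C₃, hC₃⟩ : ∃ C : ℝ, C = (x₂ + 1) ^ 2 + 2 + C₂ := ⟨_, rfl⟩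
  obtain ⟨C₄, hC₄⟩ : ∃ C : ℝ, C = C₂ * x₂ + C₃ + x₂ + 2 := ⟨_, rfl⟩
  have hC₁0 : 0 < C₁ := by rw [hC₁]; positivity
  have hC₂0 : 0 < C₂ := by linarith
  have hC₃0 : 0 < C₃ := by rw [hC₃]; positivity
  have hC₄0 : 0 < C₄ := by rw [hC₄]; positivity
  refine ⟨min (min 1 (D / 4)) (2 * x₁ ^ 2 * δ / C₄), by positivity, fun η hη hη' => ?_⟩
  have hη1 : η ≤ 1 := hη'.trans ((min_le_left _ _).trans (min_le_left _ _))
  have hηD : η ≤ D / 4 := hη'.trans ((min_le_left _ _).trans (min_le_right _ _))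
  have hηδ : η * C₄ ≤ 2 * x₁ ^ 2 * δ := (le_div_iff₀ hC₄0).1 (hη'.trans (min_le_right _ _))
  -- Chosen so that |4 z e| ≤ η, the same order as the imaginary part of z.
  refine ⟨η / (4 * (x₂ + 1)), by positivity, fun x hx m hm => ?_⟩
  have hd := hdisc x hx
  obtain ⟨hx1, hx2⟩ := hx
  have hx0 : 0 < x := hx₁.trans_le hx1
  set z : ℂ := ⟨x, η⟩ with hz
  set e := mpDefect y z m with he
  -- Completing the square: w² is the discriminant at z plus 4 z e, so w is nearly a real square
  -- root of a number at least D. No choice between the two roots is made.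
  set w : ℂ := 2 * z * m + z + 1 - y with hw
  have hzn : ‖z‖ ≤ x₂ + 1 := by
    refine (Complex.norm_le_abs_re_add_abs_im z).trans ?_
    simp only [hz]
    rw [abs_of_pos (by linarith), abs_of_pos hη]; linarith
  have hze : ‖4 * z * e‖ ≤ η := by
    rw [norm_mul, norm_mul]
    calc ‖(4 : ℂ)‖ * ‖z‖ * ‖e‖ ≤ 4 * (x₂ + 1) * (η / (4 * (x₂ + 1))) := by
          gcongr; simp
      _ = η := by field_simp
  have hw2 : w ^ 2 = z ^ 2 - 2 * (1 + y) * z + (1 - y) ^ 2 + 4 * z * e := by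
    rw [hw, he]; unfold mpDefect; ring
  have hre := (abs_le.1 ((Complex.abs_re_le_norm _).trans hze))
  have him := (abs_le.1 ((Complex.abs_im_le_norm _).trans hze))
  have eqre : w.re ^ 2 - w.im ^ 2
      = x ^ 2 - η ^ 2 - 2 * (1 + y) * x + (1 - y) ^ 2 + (4 * z * e).re := by
    have := congrArg Complex.re hw2
    simp only [Complex.add_re] at this
    rw [← sub_eq_iff_eq_add] at this
    rw [← sub_eq_iff_eq_add, ← sub_eq_zero]
    rw [← sub_eq_zero] at this
    rw [← this]
    simp only [pow_two, hz, Complex.mul_re, Complex.mul_im, Complex.add_re,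
      Complex.add_im, Complex.sub_re, Complex.sub_im, Complex.ofReal_re, Complex.ofReal_im,
      Complex.one_re, Complex.one_im, Complex.re_ofNat, Complex.im_ofNat]
    ring
  have eqim : 2 * w.re * w.im = η * (2 * x - 2 * (1 + y)) + (4 * z * e).im := by
    have := congrArg Complex.im hw2
    simp only [Complex.add_im] at this
    rw [← sub_eq_iff_eq_add] at this
    rw [← sub_eq_iff_eq_add, ← sub_eq_zero]
    rw [← sub_eq_zero] at this
    rw [← this]
    simp only [pow_two, hz, Complex.mul_re, Complex.mul_im, Complex.add_re,
      Complex.add_im, Complex.sub_re, Complex.sub_im, Complex.ofReal_re, Complex.ofReal_im,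
      Complex.one_re, Complex.one_im, Complex.re_ofNat, Complex.im_ofNat]
    ring
  generalize (4 * z * e).re = re at *
  generalize (4 * z * e).im = im at *
  -- Solve for m = (w - z - 1 + y)/(2z) and take imaginary parts after multiplying by the conjugate
  -- of z.
  have key : 2 * (x ^ 2 + η ^ 2) * m.im = (w.im - η) * x - (w.re - x - 1 + y) * η := by
    have h1 : w.re = 2 * (x * m.re - η * m.im) + x + 1 - y := by
      simp [hw, hz]; ring
    have h2 : w.im = 2 * (x * m.im + η * m.re) + η := by
      simp [hw, hz]; ring
    rw [h1, h2]; ring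
  generalize w.re = P at *
  generalize w.im = Q at *
  clear_value e w z
  have hηη : η ^ 2 ≤ η := by nlinarith only [hη, hη1]
  -- The real part of w² keeps |P| away from 0, while the imaginary part gives P Q = O(η); hence Q =
  -- O(η), and so Im m = O(η).
  have hP : D / 2 ≤ P ^ 2 := by linarith [sq_nonneg Q, hre.1]
  have hPQ : |2 * P * Q| ≤ η * C₁ := by
    have h1 : η * (2 * x - 2 * (1 + y)) ≤ η * (2 * x₂) := by gcongr; linarith
    have h2 : η * (-4) ≤ η * (2 * x - 2 * (1 + y)) := by gcongr; linarith
    have h3 : 0 ≤ η * x₂ := by positivity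
    rw [eqim, abs_le, hC₁]; constructor <;> linarith [him.1, him.2]
  have hPQ2 : (2 * P * Q) ^ 2 ≤ (η * C₁) ^ 2 := sq_le_sq' (abs_le.1 hPQ).1 (abs_le.1 hPQ).2
  have hQ2 : Q ^ 2 ≤ η ^ 2 * (C₂ - 1) := by
    rw [hC₂, add_sub_cancel_right, ← mul_div_assoc, le_div_iff₀ (by positivity)]
    have := mul_le_mul_of_nonneg_right hP (sq_nonneg Q)
    linarith
  have hQ : Q ≤ η * C₂ := by
    refine le_of_abs_le (abs_le_of_sq_le_sq ?_ (mul_pos hη hC₂0).le)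
    have : η ^ 2 * (C₂ - 1) ≤ η ^ 2 * C₂ ^ 2 := by gcongr; nlinarith only [hC₂1]
    rw [mul_pow]; exact hQ2.trans this
  have hPb : -P ≤ C₃ := by
    have h1 : η ^ 2 * (C₂ - 1) ≤ 1 * (C₂ - 1) := by gcongr; linarith
    have h2 : x ^ 2 ≤ x₂ ^ 2 := by gcongr
    have h3 : (1 - y) ^ 2 ≤ 1 := by nlinarith only [hy0, hy1]
    have h4 : 0 ≤ (1 + y) * x := by positivity
    have h5 : P ^ 2 ≤ x₂ ^ 2 + 1 + C₂ := by linarith [sq_nonneg η]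
    have h6 : -(2 * P) ≤ P ^ 2 + 1 := by linarith [sq_nonneg (P + 1)]
    nlinarith only [hC₃, h5, h6, hx₂, hC₂0]
  by_contra! hcon
  have h5 : 2 * x₁ ^ 2 * δ < 2 * (x ^ 2 + η ^ 2) * m.im := by
    have : x₁ ^ 2 ≤ x ^ 2 + η ^ 2 := by nlinarith only [hx₁, hx1, sq_nonneg η]
    calc 2 * x₁ ^ 2 * δ < 2 * x₁ ^ 2 * m.im := by gcongr
      _ ≤ _ := by
        have := hδ.trans hcon
        gcongr 2 * ?_ * m.im
  have h6 : (Q - η) * x ≤ η * C₂ * x₂ := by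
    calc (Q - η) * x ≤ η * C₂ * x := mul_le_mul_of_nonneg_right (by linarith) hx0.le
      _ ≤ _ := by gcongr
  have h7 : -(P - x - 1 + y) * η ≤ (C₃ + x₂ + 1) * η := mul_le_mul_of_nonneg_right (by linarith) hη.le
  rw [hC₄] at hηδ
  linarith

/-- Tile the interval by J windows of radius η. Each carries mass at most 2η · d/(x₂ - x₁), and
since 2Jη = x₂ - x₁ the total is d however small η has to be. -/
theorem massBound_Ico {y x₁ x₂ D d : ℝ} (hy0 : 0 ≤ y) (hy1 : y ≤ 1) (hx₁ : 0 < x₁)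
    (hD : 0 < D) (hd : 0 < d)
    (hdisc : ∀ x ∈ Set.Icc x₁ x₂, D ≤ x ^ 2 - 2 * (1 + y) * x + (1 - y) ^ 2) :
    MassBound y (Set.Ico x₁ x₂) d := by
  rcases le_or_gt x₂ x₁ with hle | hlt
  · rw [Set.Ico_eq_empty_of_le hle]
    exact (massBound_empty y).mono (by simp) hd.le
  have hlen : 0 < x₂ - x₁ := sub_pos.2 hlt
  obtain ⟨η₀, hη₀, h⟩ := im_le_of_mpDefect hy0 hy1 hx₁ hlt hD (δ := d / (x₂ - x₁)) (by positivity) hdisc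
  obtain ⟨J, hJ⟩ := exists_nat_gt ((x₂ - x₁) / (2 * η₀))
  have hJ0 : (0 : ℝ) < J := lt_trans (by positivity) hJ
  set η : ℝ := (x₂ - x₁) / (2 * J) with hη
  have hη0 : 0 < η := by positivity
  have hJη : 2 * J * η = x₂ - x₁ := by rw [hη]; field_simp
  have hηη : η ≤ η₀ := by
    rw [div_lt_iff₀ (by positivity)] at hJ
    rw [hη, div_le_iff₀ (by positivity)]; linarith
  obtain ⟨κ, hκ, h⟩ := h η hη0 hηη
  have hwin : ∀ j < J, MassBound y
      (Set.Icc (x₁ + (2 * j + 1) * η - η) (x₁ + (2 * j + 1) * η + η)) (2 * η * (d / (x₂ - x₁))) := by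
    intro j hj
    have hj' : (j : ℝ) + 1 ≤ J := by exact_mod_cast hj
    refine massBound_window hη0 hκ fun m _ hm => ?_
    have := h (x₁ + (2 * j + 1) * η) ⟨by nlinarith [(Nat.cast_nonneg j : (0 : ℝ) ≤ j)], by nlinarith⟩ m hm
    gcongr
  refine (MassBound.biUnion _ J hwin).mono (fun x hx _ => ?_) (le_of_eq ?_)
  · simp only [Set.mem_iUnion]
    obtain ⟨hx1, hx2⟩ := hx
    have hnn : 0 ≤ (x - x₁) / (2 * η) := div_nonneg (by linarith) (by positivity)
    have hf := Nat.floor_le hnn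
    have hf' := Nat.lt_floor_add_one ((x - x₁) / (2 * η))
    rw [le_div_iff₀ (by positivity)] at hf
    rw [div_lt_iff₀ (by positivity)] at hf'
    refine ⟨⌊(x - x₁) / (2 * η)⌋₊, ?_, ?_⟩
    · rw [Nat.floor_lt hnn, div_lt_iff₀ (by positivity)]
      linarith
    · constructor <;> linarith
  · rw [← hJη]; field_simp

/-- The half-line is covered by a neighbourhood of 0, a gap ending just before a on which the
discriminant is at least ρ², and a small window around a; each costs d/3, and only the first carries
the atom 1-y. -/
theorem massBound_lower {y : ℝ} (hy0 : 0 < y) (hy1 : y ≤ 1) {d : ℝ} (hd : 0 < d) :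
    ∃ ε' : ℝ, 0 < ε' ∧ MassBound y (Set.Iio ((1 - √y) ^ 2 + ε')) (1 - y + d) := by
  obtain ⟨r, hr, h0⟩ := massBound_zero hy1 (d := d / 3) (by positivity) hy0.le
  have hs : √y ^ 2 = y := Real.sq_sqrt hy0.le
  have hs0 : 0 < √y := Real.sqrt_pos.2 hy0
  -- For y = 1 the edge a is 0, and the bound near 0 already is the claim.
  rcases eq_or_lt_of_le hy1 with rfl | hy
  · exact ⟨r, hr, h0.mono (fun x hx _ => by simpa using le_of_lt (Set.mem_Iio.1 hx)) (by linarith)⟩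
  set a := (1 - √y) ^ 2 with ha
  have hs1 : √y < 1 := by nlinarith
  have ha0 : 0 < a := by
    have : 0 < 1 - √y := by linarith
    positivity
  obtain ⟨r', hr', h1⟩ := massBound_point (y := y) hy0.le hy1 ha0 (d := d / 3) (by positivity)
  set ρ := min r' (a / 2) with hρ
  have hρ0 : 0 < ρ := by positivity
  have h1 := h1 ρ hρ0 (min_le_left _ _)
  have hρa : ρ ≤ a / 2 := min_le_right _ _
  have h2 : MassBound y (Set.Ico r (a - ρ)) (d / 3) := by
    refine massBound_Ico (D := ρ * ρ) hy0.le hy1 hr (by positivity) (by positivity) fun x hx => ?_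
    -- The other root of the discriminant is b = a + 4√y.
    have e : x ^ 2 - 2 * (1 + y) * x + (1 - y) ^ 2 = (a - x) * (a + 4 * √y - x) := by
      rw [ha, ← hs]; simp only [Real.sqrt_sq hs0.le]; ring
    rw [e]
    have := hx.2
    gcongr <;> linarith
  refine ⟨ρ, hρ0, ((h0.union h2).union h1).mono (fun x hx hx0 => ?_) (by linarith)⟩
  simp only [Set.mem_union, Set.mem_Iic, Set.mem_Icc, Set.mem_Ico, Set.mem_Iio] at hx ⊢
  rcases le_total x r with h | h
  · exact .inl (.inl h)
  rcases lt_or_ge x (a - ρ) with h' | h'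
  · exact .inl (.inr ⟨h, h'⟩)
  · exact .inr ⟨h', hx.le⟩

/-- The same gluing at the other edge: a window around b, a compact gap above it and the tail. The
gap runs to L + 1 so that the half-open interval contains L itself. -/
theorem massBound_upper {y : ℝ} (hy0 : 0 < y) (hy1 : y ≤ 1) {d : ℝ} (hd : 0 < d) :
    ∃ ε' : ℝ, 0 < ε' ∧ MassBound y (Set.Ioi ((1 + √y) ^ 2 - ε')) d := by
  obtain ⟨L, hL, h0⟩ := massBound_tail hy1 (d := d / 3) (by positivity) hy0.le
  have hs : √y ^ 2 = y := Real.sq_sqrt hy0.le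
  have hs0 : 0 < √y := Real.sqrt_pos.2 hy0
  set b := (1 + √y) ^ 2 with hb
  have hb0 : 0 < b := by positivity
  obtain ⟨ρ, hρ0, h1⟩ := massBound_point (y := y) hy0.le hy1 hb0 (d := d / 3) (by positivity)
  have h1 := h1 ρ hρ0 le_rfl
  have h2 : MassBound y (Set.Ico (b + ρ) (L + 1)) (d / 3) := by
    refine massBound_Ico (D := ρ * ρ) hy0.le hy1 (by positivity) (by positivity) (by positivity)
      fun x hx => ?_
    have e : x ^ 2 - 2 * (1 + y) * x + (1 - y) ^ 2 = (x - b) * (x - (b - 4 * √y)) := by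
      rw [hb, ← hs]; simp only [Real.sqrt_sq hs0.le]; ring
    rw [e]
    have := hx.1
    gcongr <;> linarith
  refine ⟨ρ, hρ0, ((h0.union h2).union h1).mono (fun x hx hx0 => ?_) (by linarith)⟩
  simp only [Set.mem_union, Set.mem_Ioi, Set.mem_Icc, Set.mem_Ico] at hx ⊢
  rcases lt_or_ge L x with h | h
  · exact .inl (.inl h)
  rcases le_total (b + ρ) x with h' | h'
  · exact .inl (.inr ⟨h', by linarith⟩)
  · exact .inr ⟨hx.le, h'⟩

/-! ### Resolvents and rank-one perturbations -/

section Resolvent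

open scoped ComplexOrder

theorem star_dotProduct_self_eq {ι : Type*} [Fintype ι] (v : ι → ℂ) :
    star v ⬝ᵥ v = ((∑ i, ‖v i‖ ^ 2 : ℝ) : ℂ) := by
  simp only [dotProduct, Pi.star_apply]
  push_cast
  exact Finset.sum_congr rfl fun i _ => by
    rw [RCLike.star_def, Complex.conj_mul']

theorem Matrix.IsHermitian.im_star_dotProduct_mulVec {ι : Type*} [Fintype ι] {H : Matrix ι ι ℂ}
    (hH : H.IsHermitian) (v : ι → ℂ) : (star v ⬝ᵥ H *ᵥ v).im = 0 := by
  simpa using hH.im_star_dotProduct_mulVec_self v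

theorem norm_dotProduct_le {ι : Type*} [Fintype ι] (u v : ι → ℂ) :
    ‖u ⬝ᵥ v‖ ≤ ((∑ i, ‖u i‖ ^ 2) + ∑ i, ‖v i‖ ^ 2) / 2 := by
  rw [← Finset.sum_add_distrib, Finset.sum_div, dotProduct]
  refine norm_sum_le_of_le _ fun i _ => ?_
  rw [norm_mul]
  nlinarith [sq_nonneg (‖u i‖ - ‖v i‖)]

variable {ι : Type*} [Fintype ι] [DecidableEq ι]

/-- The resolvent `(H - z)⁻¹` of a square complex matrix. -/
noncomputable def resolventMatrix (H : Matrix ι ι ℂ) (z : ℂ) : Matrix ι ι ℂ :=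
  (H - z • (1 : Matrix ι ι ℂ))⁻¹

theorem Matrix.IsHermitian.isUnit_det_sub_smul {H : Matrix ι ι ℂ} (hH : H.IsHermitian) {z : ℂ}
    (hz : z.im ≠ 0) : IsUnit (H - z • (1 : Matrix ι ι ℂ)).det := by
  rw [isUnit_iff_ne_zero]
  intro h0
  obtain ⟨v, hv, h⟩ := Matrix.exists_mulVec_eq_zero_iff.2 h0
  have h1 : (star v ⬝ᵥ (H - z • (1 : Matrix ι ι ℂ)) *ᵥ v).im = 0 := by rw [h]; simp
  rw [Matrix.sub_mulVec, Matrix.smul_mulVec, Matrix.one_mulVec, dotProduct_sub, dotProduct_smul,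
    Complex.sub_im, hH.im_star_dotProduct_mulVec, star_dotProduct_self_eq, smul_eq_mul,
    Complex.im_mul_ofReal, zero_sub, neg_eq_zero] at h1
  have h2 := (mul_eq_zero.1 h1).resolve_left hz
  rw [Finset.sum_eq_zero_iff_of_nonneg fun i _ => by positivity] at h2
  exact hv (funext fun i => by simpa using h2 i (Finset.mem_univ i))

theorem sub_smul_mul_resolventMatrix {H : Matrix ι ι ℂ} (hH : H.IsHermitian) {z : ℂ}
    (hz : z.im ≠ 0) : (H - z • (1 : Matrix ι ι ℂ)) * resolventMatrix H z = 1 :=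
  Matrix.mul_nonsing_inv _ (hH.isUnit_det_sub_smul hz)

theorem mulVec_resolventMatrix {H : Matrix ι ι ℂ} (hH : H.IsHermitian) {z : ℂ} (hz : z.im ≠ 0)
    (x : ι → ℂ) : H *ᵥ (resolventMatrix H z *ᵥ x) - z • (resolventMatrix H z *ᵥ x) = x := by
  have := congrArg (fun A => A *ᵥ x) (sub_smul_mul_resolventMatrix hH hz)
  simpa [← Matrix.mulVec_mulVec, Matrix.sub_mulVec, Matrix.smul_mulVec] using this

theorem conjTranspose_resolventMatrix {H : Matrix ι ι ℂ} (hH : H.IsHermitian) (z : ℂ) :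
    (resolventMatrix H z)ᴴ = resolventMatrix H (star z) := by
  rw [resolventMatrix, resolventMatrix, Matrix.conjTranspose_nonsing_inv,
    Matrix.conjTranspose_sub, hH.eq, Matrix.conjTranspose_smul, Matrix.conjTranspose_one]

/-- With `v = R x`: `x* R x = v* H v - conj z * |v|²`. -/
theorem star_dotProduct_resolventMatrix {H : Matrix ι ι ℂ} (hH : H.IsHermitian) {z : ℂ}
    (hz : z.im ≠ 0) (x : ι → ℂ) :
    star x ⬝ᵥ resolventMatrix H z *ᵥ x
      = star (resolventMatrix H z *ᵥ x) ⬝ᵥ H *ᵥ (resolventMatrix H z *ᵥ x)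
        - star z * ((∑ i, ‖(resolventMatrix H z *ᵥ x) i‖ ^ 2 : ℝ) : ℂ) := by
  set v := resolventMatrix H z *ᵥ x with hv
  have h := mulVec_resolventMatrix hH hz x
  rw [← hv] at h
  conv_lhs => rw [← h]
  rw [star_sub, star_smul, sub_dotProduct, smul_dotProduct, star_dotProduct_self_eq, smul_eq_mul,
    Matrix.star_mulVec, hH.eq, ← Matrix.dotProduct_mulVec]

/-- The Ward identity: the term v* H v is real for Hermitian H, so only -conj z · |v|² contributes.
-/
theorem im_star_dotProduct_resolventMatrix {H : Matrix ι ι ℂ} (hH : H.IsHermitian) {z : ℂ}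
    (hz : z.im ≠ 0) (x : ι → ℂ) :
    (star x ⬝ᵥ resolventMatrix H z *ᵥ x).im
      = z.im * ∑ i, ‖(resolventMatrix H z *ᵥ x) i‖ ^ 2 := by
  rw [star_dotProduct_resolventMatrix hH hz, Complex.sub_im, hH.im_star_dotProduct_mulVec,
    Complex.im_mul_ofReal]
  simp

theorem im_star_dotProduct_resolventMatrix' {H : Matrix ι ι ℂ} (hH : H.IsHermitian) {z : ℂ}
    (hz : z.im ≠ 0) (x : ι → ℂ) :
    (star x ⬝ᵥ resolventMatrix H z *ᵥ x).im
      = z.im * ∑ i, ‖((resolventMatrix H z)ᴴ *ᵥ x) i‖ ^ 2 := by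
  have h := im_star_dotProduct_resolventMatrix hH (z := star z) (by simpa using hz) x
  rw [← conjTranspose_resolventMatrix hH] at h
  have e : star x ⬝ᵥ (resolventMatrix H z)ᴴ *ᵥ x = star (star x ⬝ᵥ resolventMatrix H z *ᵥ x) := by
    rw [Matrix.star_dotProduct, Matrix.star_mulVec, ← Matrix.dotProduct_mulVec,
      Matrix.conjTranspose_conjTranspose]
  rw [e] at h
  simp only [RCLike.star_def, Complex.conj_im] at h
  linarith

/-- With v = R x, the product equals z · v* H v - |z|² |v|², whose imaginary part is Im z · v* H v.
Positivity of H enters here, and it later keeps the Sherman–Morrison denominators away from 0. -/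
theorem im_mul_star_dotProduct_resolventMatrix_nonneg {H : Matrix ι ι ℂ} (hH : H.PosSemidef)
    {z : ℂ} (hz : 0 < z.im) (x : ι → ℂ) :
    0 ≤ (z * (star x ⬝ᵥ resolventMatrix H z *ᵥ x)).im := by
  have h1 := hH.isHermitian.im_star_dotProduct_mulVec (resolventMatrix H z *ᵥ x)
  have h2 := hH.re_dotProduct_nonneg (resolventMatrix H z *ᵥ x)
  rw [star_dotProduct_resolventMatrix hH.isHermitian hz.ne', mul_sub, ← mul_assoc]
  have h3 : z * star z = ((‖z‖ ^ 2 : ℝ) : ℂ) := by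
    rw [RCLike.star_def, Complex.mul_conj']; push_cast; rfl
  rw [h3, ← Complex.ofReal_mul, Complex.sub_im, Complex.ofReal_im, Complex.mul_im, h1]
  simp only [mul_zero, zero_add, sub_zero]
  exact mul_nonneg hz.le h2

/-- The Ward identity at a basis vector bounds Im z times the column sum s by |R j j| ≤ √s, and the
inequality closes on itself. -/
theorem sum_norm_sq_resolventMatrix_col_le {H : Matrix ι ι ℂ} (hH : H.IsHermitian) {z : ℂ}
    (hz : 0 < z.im) (j : ι) : ∑ i, ‖resolventMatrix H z i j‖ ^ 2 ≤ (z.im⁻¹) ^ 2 := by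
  have h := im_star_dotProduct_resolventMatrix hH hz.ne' (Pi.single j 1)
  have e : ∀ i, (resolventMatrix H z *ᵥ Pi.single j 1) i = resolventMatrix H z i j := by simp
  simp only [e] at h
  have e2 : star (Pi.single j (1 : ℂ) : ι → ℂ) ⬝ᵥ resolventMatrix H z *ᵥ Pi.single j 1
      = resolventMatrix H z j j := by
    rw [← Pi.single_star, star_one, single_dotProduct, one_mul, e]
  rw [e2] at h
  set s := ∑ i, ‖resolventMatrix H z i j‖ ^ 2
  have h1 : ‖resolventMatrix H z j j‖ ^ 2 ≤ s :=
    Finset.single_le_sum (f := fun i => ‖resolventMatrix H z i j‖ ^ 2)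
      (fun i _ => by positivity) (Finset.mem_univ j)
  have h2 : z.im * s ≤ ‖resolventMatrix H z j j‖ := h ▸ (Complex.im_le_norm _)
  clear_value s
  have hs : 0 ≤ s := (sq_nonneg _).trans h1
  have h3 : (z.im * s) ^ 2 ≤ s := (pow_le_pow_left₀ (mul_nonneg hz.le hs) h2 2).trans h1
  rcases hs.eq_or_lt with rfl | hs
  · positivity
  rw [inv_pow, le_inv_comm₀ hs (by positivity), le_inv_comm₀ (by positivity) hs, ← one_div,
    le_div_iff₀ (by positivity)]
  have : s * (s * z.im ^ 2) ≤ s * 1 := by linarith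
  exact le_of_mul_le_mul_left this hs

theorem norm_resolventMatrix_apply_le {H : Matrix ι ι ℂ} (hH : H.IsHermitian) {z : ℂ}
    (hz : 0 < z.im) (i j : ι) : ‖resolventMatrix H z i j‖ ≤ z.im⁻¹ := by
  refine le_of_abs_le (abs_le_of_sq_le_sq ?_ (inv_nonneg.2 hz.le))
  exact (Finset.single_le_sum (f := fun i => ‖resolventMatrix H z i j‖ ^ 2)
      (fun i _ => by positivity) (Finset.mem_univ i)).trans
    (sum_norm_sq_resolventMatrix_col_le hH hz j)

/-- `1 + c x* R x` stays away from zero. -/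
theorem le_norm_one_add_quadForm {H : Matrix ι ι ℂ} (hH : H.PosSemidef) {z : ℂ} (hz : 0 < z.im)
    {c : ℝ} (hc : 0 ≤ c) (x : ι → ℂ) :
    z.im ≤ ‖z‖ * ‖1 + c * (star x ⬝ᵥ resolventMatrix H z *ᵥ x)‖ := by
  rw [← norm_mul]
  refine le_trans ?_ (Complex.im_le_norm _)
  rw [mul_add, mul_one, Complex.add_im, mul_left_comm, Complex.im_ofReal_mul]
  have := mul_nonneg hc (im_mul_star_dotProduct_resolventMatrix_nonneg hH hz x)
  linarith

theorem one_add_quadForm_ne_zero {H : Matrix ι ι ℂ} (hH : H.PosSemidef) {z : ℂ} (hz : 0 < z.im)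
    {c : ℝ} (hc : 0 ≤ c) (x : ι → ℂ) :
     1 + c * (star x ⬝ᵥ resolventMatrix H z *ᵥ x) ≠ 0 := by
  intro h
  have := le_norm_one_add_quadForm hH hz hc x
  rw [h, norm_zero, mul_zero] at this
  linarith

/-- The Sherman–Morrison formula for the resolvent. -/
theorem resolventMatrix_add_rankOne {H : Matrix ι ι ℂ} (hH : H.PosSemidef) {z : ℂ} (hz : 0 < z.im)
    {c : ℝ} (hc : 0 ≤ c) (x : ι → ℂ) :
    resolventMatrix (H + (c : ℂ) • Matrix.vecMulVec x (star x)) z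
      = resolventMatrix H z - (c / (1 + c * (star x ⬝ᵥ resolventMatrix H z *ᵥ x))) •
        Matrix.vecMulVec (resolventMatrix H z *ᵥ x) (star x ᵥ* resolventMatrix H z) := by
  have hq := one_add_quadForm_ne_zero hH hz hc x
  set q := star x ⬝ᵥ resolventMatrix H z *ᵥ x with hqdef
  have h1 := sub_smul_mul_resolventMatrix hH.isHermitian hz.ne'
  set R := resolventMatrix H z with hR
  refine Matrix.inv_eq_right_inv ?_
  have e : H + (c : ℂ) • Matrix.vecMulVec x (star x) - z • (1 : Matrix ι ι ℂ)
      = (H - z • (1 : Matrix ι ι ℂ)) + (c : ℂ) • Matrix.vecMulVec x (star x) := by abel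
  rw [e, add_mul, mul_sub, mul_sub, h1, mul_smul_comm, Matrix.mul_vecMulVec, Matrix.mulVec_mulVec,
    h1, Matrix.one_mulVec, smul_mul_assoc, smul_mul_assoc, mul_smul_comm, Matrix.vecMulVec_mul,
    Matrix.vecMulVec_mul_vecMulVec, ← hqdef]
  simp only [Matrix.vecMulVec_smul, smul_smul]
  ext i j
  simp only [Matrix.add_apply, Matrix.sub_apply, Matrix.smul_apply, smul_eq_mul]
  field_simp
  ring

theorem quadForm_resolventMatrix_add_rankOne {H : Matrix ι ι ℂ} (hH : H.PosSemidef) {z : ℂ} (hz : 0 < z.im)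
    {c : ℝ} (hc : 0 ≤ c) (x : ι → ℂ) :
    c * (star x ⬝ᵥ resolventMatrix (H + (c : ℂ) • Matrix.vecMulVec x (star x)) z *ᵥ x)
      = c * (star x ⬝ᵥ resolventMatrix H z *ᵥ x)
        / (1 + c * (star x ⬝ᵥ resolventMatrix H z *ᵥ x)) := by
  have hq := one_add_quadForm_ne_zero hH hz hc x
  rw [resolventMatrix_add_rankOne hH hz hc, Matrix.sub_mulVec, Matrix.smul_mulVec,
    Matrix.vecMulVec_mulVec, dotProduct_sub, dotProduct_smul]
  rw [← Matrix.dotProduct_mulVec]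
  set q := star x ⬝ᵥ resolventMatrix H z *ᵥ x with hqdef
  simp
  rw [← hqdef]
  field_simp
  ring

/-- By Sherman–Morrison the difference is c x* R² x / (1 + c q). The numerator is controlled by the
Ward identities for R and its adjoint, |x* R² x| ≤ Im q / Im z, and c · Im q ≤ |1 + c q|; hence the
bound does not depend on x. -/
theorem norm_trace_resolventMatrix_sub_le {H : Matrix ι ι ℂ} (hH : H.PosSemidef) {z : ℂ} (hz : 0 < z.im)
    {c : ℝ} (hc : 0 ≤ c) (x : ι → ℂ) :
    ‖(resolventMatrix (H + (c : ℂ) • Matrix.vecMulVec x (star x)) z).trace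
      - (resolventMatrix H z).trace‖ ≤ z.im⁻¹ := by
  have hq := one_add_quadForm_ne_zero hH hz hc x
  have h1 := im_star_dotProduct_resolventMatrix hH.isHermitian hz.ne' x
  have h2 := im_star_dotProduct_resolventMatrix' hH.isHermitian hz.ne' x
  rw [resolventMatrix_add_rankOne hH hz hc, Matrix.trace_sub, Matrix.trace_smul,
    Matrix.trace_vecMulVec, sub_sub_cancel_left, norm_neg, smul_eq_mul, norm_mul, norm_div,
    Complex.norm_real, Real.norm_eq_abs, abs_of_nonneg hc]
  set R := resolventMatrix H z with hR
  set q := star x ⬝ᵥ R *ᵥ x with hqdef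
  have h3 : ‖R *ᵥ x ⬝ᵥ star x ᵥ* R‖ ≤ q.im / z.im := by
    refine (norm_dotProduct_le _ _).trans (le_of_eq ?_)
    have e : star x ᵥ* R = star (Rᴴ *ᵥ x) := by
      rw [Matrix.star_mulVec, Matrix.conjTranspose_conjTranspose]
    rw [e]
    simp only [Pi.star_apply, norm_star]
    field_simp
    linarith
  have h4 : c * q.im ≤ ‖1 + c * q‖ := by
    refine le_trans (le_of_eq ?_) (Complex.im_le_norm _)
    simp
  have h5 : 0 < ‖1 + c * q‖ := norm_pos_iff.2 hq
  calc c / ‖1 + c * q‖ * ‖R *ᵥ x ⬝ᵥ star x ᵥ* R‖ ≤ c / ‖1 + c * q‖ * (q.im / z.im) := by gcongr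
    _ = (c * q.im / ‖1 + c * q‖) * z.im⁻¹ := by field_simp
    _ ≤ 1 * z.im⁻¹ := by gcongr; exact div_le_one_of_le₀ h4 h5.le
    _ = z.im⁻¹ := one_mul _

end Resolvent

/-! ### The self-consistent equation for Gram matrices -/

section RowGram

open scoped ComplexOrder

/-- The normalised Gram matrix `(1/n) ∑ xᵢ* xᵢ` of the rows `xᵢ`, `i ∈ s`. -/
noncomputable def rowGram {p n : ℕ} (s : Finset (Fin p)) (X : Fin p → Fin n → ℂ) :
    Matrix (Fin n) (Fin n) ℂ :=
  ∑ i ∈ s, (((n : ℝ)⁻¹ : ℝ) : ℂ) • Matrix.vecMulVec (star (X i)) (star (star (X i)))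

theorem covarianceMatrix_eq_rowGram {p n : ℕ} (M : Matrix (Fin p) (Fin n) ℂ) :
    covarianceMatrix M = rowGram Finset.univ M := by
  ext j k
  simp [covarianceMatrix, rowGram, Matrix.mul_apply, Matrix.sum_apply, Matrix.vecMulVec_apply,
    Finset.mul_sum]

theorem rowGram_posSemidef {p n : ℕ} (s : Finset (Fin p)) (X : Fin p → Fin n → ℂ) :
    (rowGram s X).PosSemidef := by
  refine Matrix.posSemidef_sum _ fun i _ => ?_
  refine (Matrix.posSemidef_vecMulVec_self_star _).smul ?_
  rw [Complex.zero_le_real]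
  positivity

theorem rowGram_isHermitian {p n : ℕ} (s : Finset (Fin p)) (X : Fin p → Fin n → ℂ) :
    (rowGram s X).IsHermitian :=
  (rowGram_posSemidef s X).isHermitian

theorem rowGram_eq_erase_add {p n : ℕ} (X : Fin p → Fin n → ℂ) (i : Fin p) :
    rowGram Finset.univ X = rowGram (Finset.univ.erase i) X
      + (((n : ℝ)⁻¹ : ℝ) : ℂ) • Matrix.vecMulVec (star (X i)) (star (star (X i))) :=
  (Finset.sum_erase_add _ _ (Finset.mem_univ i)).symm

theorem rowGram_erase_update {p n : ℕ} (X : Fin p → Fin n → ℂ) (i : Fin p) (x : Fin n → ℂ) :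
    rowGram (Finset.univ.erase i) (Function.update X i x) = rowGram (Finset.univ.erase i) X := by
  refine Finset.sum_congr rfl fun k hk => ?_
  rw [Function.update_of_ne (Finset.ne_of_mem_erase hk)]

/-- The Stieltjes transform `(1/n) tr (W - z)⁻¹`. -/
noncomputable def gramStieltjes {p n : ℕ} (s : Finset (Fin p)) (X : Fin p → Fin n → ℂ) (z : ℂ) :
    ℂ := (n : ℂ)⁻¹ * (resolventMatrix (rowGram s X) z).trace

/-- The quadratic form `(1/n) xᵢ (W⁽ⁱ⁾ - z)⁻¹ xᵢ*` of the `i`-th row in the resolvent of the other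
rows. -/
noncomputable def rowQuadForm {p n : ℕ} (X : Fin p → Fin n → ℂ) (z : ℂ) (i : Fin p) : ℂ :=
  (n : ℂ)⁻¹ * (X i ⬝ᵥ resolventMatrix (rowGram (Finset.univ.erase i) X) z *ᵥ star (X i))

theorem norm_gramStieltjes_le {p n : ℕ} (s : Finset (Fin p)) (X : Fin p → Fin n → ℂ) {z : ℂ}
    (hz : 0 < z.im) : ‖gramStieltjes s X z‖ ≤ z.im⁻¹ := by
  rcases Nat.eq_zero_or_pos n with rfl | hn
  · simp [gramStieltjes, hz.le]
  have hn' : (0 : ℝ) < n := by exact_mod_cast hn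
  rw [gramStieltjes, norm_mul, norm_inv, Complex.norm_natCast, inv_mul_le_iff₀ hn', Matrix.trace]
  refine (norm_sum_le_of_le _ fun i _ =>
    norm_resolventMatrix_apply_le (rowGram_isHermitian s X) hz i i).trans ?_
  simp

theorem norm_gramStieltjes_sub_erase_le {p n : ℕ} (X : Fin p → Fin n → ℂ) {z : ℂ}
    (hz : 0 < z.im) (i : Fin p) :
    ‖gramStieltjes Finset.univ X z - gramStieltjes (Finset.univ.erase i) X z‖
      ≤ (n : ℝ)⁻¹ * z.im⁻¹ := by
  rw [gramStieltjes, gramStieltjes, ← mul_sub, norm_mul, norm_inv, Complex.norm_natCast,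
    rowGram_eq_erase_add X i]
  gcongr
  exact norm_trace_resolventMatrix_sub_le (rowGram_posSemidef _ X) hz (by positivity) _

/-- Deleting row i gives the same matrix before and after the replacement, so two rank-one steps
suffice. This is the bounded-difference estimate. -/
theorem norm_gramStieltjes_update_sub_le {p n : ℕ} (X : Fin p → Fin n → ℂ) {z : ℂ}
    (hz : 0 < z.im) (i : Fin p) (x : Fin n → ℂ) :
    ‖gramStieltjes Finset.univ (Function.update X i x) z - gramStieltjes Finset.univ X z‖
      ≤ 2 * ((n : ℝ)⁻¹ * z.im⁻¹) := by
  have h1 := norm_gramStieltjes_sub_erase_le X hz i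
  have h2 := norm_gramStieltjes_sub_erase_le (Function.update X i x) hz i
  have e : gramStieltjes (Finset.univ.erase i) (Function.update X i x) z
      = gramStieltjes (Finset.univ.erase i) X z := by
    rw [gramStieltjes, gramStieltjes, rowGram_erase_update]
  rw [e] at h2
  rw [norm_sub_rev] at h1
  calc _ = ‖(gramStieltjes Finset.univ (Function.update X i x) z
        - gramStieltjes (Finset.univ.erase i) X z)
        + (gramStieltjes (Finset.univ.erase i) X z - gramStieltjes Finset.univ X z)‖ := by
        congr 1; ring
    _ ≤ _ := (norm_add_le _ _).trans (by linarith)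

/-- Take the trace of (W - z) R = 1 and split W into its rank-one rows; by Sherman–Morrison each row
contributes qᵢ/(1 + qᵢ). -/
theorem sum_rowQuadForm_div {p n : ℕ} (hn : 0 < n) (X : Fin p → Fin n → ℂ) {z : ℂ}
    (hz : 0 < z.im) :
    ∑ i, rowQuadForm X z i / (1 + rowQuadForm X z i)
      = n * (1 + z * gramStieltjes Finset.univ X z) := by
  have hn' : (n : ℂ) ≠ 0 := by exact_mod_cast hn.ne'
  have h1 : ∀ i, rowQuadForm X z i / (1 + rowQuadForm X z i)
      = (n : ℂ)⁻¹ * (X i ⬝ᵥ resolventMatrix (rowGram Finset.univ X) z *ᵥ star (X i)) := by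
    intro i
    have := quadForm_resolventMatrix_add_rankOne (rowGram_posSemidef (Finset.univ.erase i) X) hz
      (c := (n : ℝ)⁻¹) (by positivity) (star (X i))
    rw [← rowGram_eq_erase_add, star_star] at this
    rw [rowQuadForm]
    push_cast at this
    exact this.symm
  have h2 := congrArg Matrix.trace
    (sub_smul_mul_resolventMatrix (rowGram_isHermitian Finset.univ X) hz.ne')
  rw [sub_mul, Matrix.trace_sub, smul_mul_assoc, one_mul, Matrix.trace_smul, Matrix.trace_one,
    Fintype.card_fin] at h2
  have h4 : rowGram Finset.univ X * resolventMatrix (rowGram Finset.univ X) z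
      = ∑ i, ((((n : ℝ)⁻¹ : ℝ) : ℂ) • Matrix.vecMulVec (star (X i)) (star (star (X i))))
        * resolventMatrix (rowGram Finset.univ X) z := by
    rw [← Finset.sum_mul]; rfl
  rw [h4, Matrix.trace_sum] at h2
  simp_rw [h1]
  have h3 : ∀ i, ((((n : ℝ)⁻¹ : ℝ) : ℂ) • Matrix.vecMulVec (star (X i)) (star (star (X i)))
      * resolventMatrix (rowGram Finset.univ X) z).trace
      = (n : ℂ)⁻¹ * (X i ⬝ᵥ resolventMatrix (rowGram Finset.univ X) z *ᵥ star (X i)) := by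
    intro i
    rw [smul_mul_assoc, Matrix.trace_smul, Matrix.vecMulVec_mul, Matrix.trace_vecMulVec,
      dotProduct_comm, ← Matrix.dotProduct_mulVec, star_star]
    simp
  simp_rw [h3] at h2
  rw [smul_eq_mul] at h2
  rw [gramStieltjes]
  linear_combination h2 - z * (resolventMatrix (rowGram Finset.univ X) z).trace
    * mul_inv_cancel₀ hn'

theorem mpDefect_eq (y : ℝ) (z m : ℂ) : mpDefect y z m = (1 + z * m) * (1 + m) - y * m := by
  unfold mpDefect; ring

/-- The trace identity gives the defect exactly as the average (1/n) ∑ (qᵢ - m)/(1 + qᵢ) plus (p/n -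
y) m. The denominators satisfy |1 + qᵢ| ≥ Im z / |z|, and passing from m to the transform without
row i costs 1/(n Im z). -/
theorem norm_mpDefect_gramStieltjes_le {p n : ℕ} (hn : 0 < n) (y : ℝ) (X : Fin p → Fin n → ℂ)
    {z : ℂ} (hz : 0 < z.im) :
    ‖mpDefect y z (gramStieltjes Finset.univ X z)‖
      ≤ ‖z‖ / z.im * ((n : ℝ)⁻¹ * ∑ i, (‖rowQuadForm X z i
          - gramStieltjes (Finset.univ.erase i) X z‖ + (n : ℝ)⁻¹ * z.im⁻¹))
        + |(p : ℝ) / n - y| * z.im⁻¹ := by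
  have hn' : (n : ℂ) ≠ 0 := by exact_mod_cast hn.ne'
  have hq : ∀ i, z.im ≤ ‖z‖ * ‖1 + rowQuadForm X z i‖ := fun i => by
    have := le_norm_one_add_quadForm (rowGram_posSemidef (Finset.univ.erase i) X) hz
      (c := (n : ℝ)⁻¹) (by positivity) (star (X i))
    rw [star_star] at this
    rw [rowQuadForm]
    push_cast at this
    exact this
  have hq0 : ∀ i, 1 + rowQuadForm X z i ≠ 0 := fun i h => by
    have := hq i
    rw [h, norm_zero, mul_zero] at this
    linarith
  set m := gramStieltjes Finset.univ X z with hm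
  have e : mpDefect y z m = (n : ℂ)⁻¹ * ∑ i, (rowQuadForm X z i - m) / (1 + rowQuadForm X z i)
      + (((p : ℝ) / n - y : ℝ) : ℂ) * m := by
    have h1 : ∀ i, (rowQuadForm X z i - m) / (1 + rowQuadForm X z i)
        = (1 + m) * (rowQuadForm X z i / (1 + rowQuadForm X z i)) - m := fun i => by
      have := hq0 i
      field_simp
      ring
    simp_rw [h1]
    rw [Finset.sum_sub_distrib, ← Finset.mul_sum, sum_rowQuadForm_div hn X hz, ← hm, mpDefect_eq]
    simp
    field_simp
    ring
  rw [e]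
  refine (norm_add_le _ _).trans (add_le_add ?_ ?_)
  · rw [norm_mul, norm_inv, Complex.norm_natCast, mul_left_comm]
    gcongr
    rw [Finset.mul_sum]
    refine norm_sum_le_of_le _ fun i _ => ?_
    have h2 : ‖rowQuadForm X z i - m‖ ≤ ‖rowQuadForm X z i
        - gramStieltjes (Finset.univ.erase i) X z‖ + (n : ℝ)⁻¹ * z.im⁻¹ := by
      have := norm_gramStieltjes_sub_erase_le X hz i
      rw [← hm, norm_sub_rev] at this
      have := norm_sub_le_norm_sub_add_norm_sub (rowQuadForm X z i)
        (gramStieltjes (Finset.univ.erase i) X z) m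
      linarith
    have h3 : 0 < ‖1 + rowQuadForm X z i‖ := norm_pos_iff.2 (hq0 i)
    rw [norm_div, div_le_iff₀ h3]
    refine h2.trans ?_
    have h4 : 1 ≤ ‖z‖ / z.im * ‖1 + rowQuadForm X z i‖ := by
      rw [div_mul_eq_mul_div, one_le_div hz]; exact hq i
    have h5 := (norm_nonneg _).trans h2
    nlinarith
  · rw [norm_mul, Complex.norm_real, Real.norm_eq_abs]
    gcongr
    exact norm_gramStieltjes_le _ X hz

theorem norm_mpDefect_sub_le {y : ℝ} (hy0 : 0 ≤ y) (hy1 : y ≤ 1) (z : ℂ) {m m' : ℂ} {b : ℝ}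
    (hm : ‖m‖ ≤ b) (hm' : ‖m'‖ ≤ b) :
    ‖mpDefect y z m - mpDefect y z m'‖ ≤ (‖z‖ * (2 * b) + (‖z‖ + 1)) * ‖m - m'‖ := by
  have e : mpDefect y z m - mpDefect y z m' = (z * (m + m') + (z + ((1 - y : ℝ) : ℂ))) * (m - m') := by
    unfold mpDefect; push_cast; ring
  rw [e, norm_mul]
  gcongr
  refine (norm_add_le _ _).trans (add_le_add ?_ ((norm_add_le _ _).trans ?_))
  · rw [norm_mul]
    gcongr
    exact (norm_add_le _ _).trans (by linarith)
  · rw [Complex.norm_real, Real.norm_eq_abs, abs_of_nonneg (by linarith)]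
    linarith

theorem trace_resolventMatrix {ι : Type*} [Fintype ι] [DecidableEq ι] {H : Matrix ι ι ℂ}
    (hH : H.IsHermitian) {z : ℂ} (hz : z.im ≠ 0) :
    (resolventMatrix H z).trace = ∑ i, ((hH.eigenvalues i : ℂ) - z)⁻¹ := by
  set φ := Unitary.conjStarAlgAut ℂ (Matrix ι ι ℂ) hH.eigenvectorUnitary with hφ
  have hne : ∀ i, (hH.eigenvalues i : ℂ) - z ≠ 0 := fun i h => hz (by
    simpa using congrArg Complex.im h)
  have e : H - z • (1 : Matrix ι ι ℂ)
      = φ (Matrix.diagonal fun i => (hH.eigenvalues i : ℂ) - z) := by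
    have h1 : (Matrix.diagonal fun i => (hH.eigenvalues i : ℂ) - z)
        = Matrix.diagonal (RCLike.ofReal ∘ hH.eigenvalues) - z • (1 : Matrix ι ι ℂ) := by
      rw [← Matrix.diagonal_one, ← Matrix.diagonal_smul, Matrix.diagonal_sub]
      congr 1
      ext i
      simp
    rw [h1, map_sub, map_smul, map_one, ← hH.spectral_theorem]
  have h2 : resolventMatrix H z = φ (Matrix.diagonal fun i => ((hH.eigenvalues i : ℂ) - z)⁻¹) := by
    refine Matrix.inv_eq_right_inv ?_
    rw [e, ← map_mul, Matrix.diagonal_mul_diagonal]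
    simp [hne]
  rw [h2, hφ, Unitary.conjStarAlgAut_apply, Matrix.trace_mul_comm, ← mul_assoc,
    Unitary.coe_star_mul_self, one_mul, Matrix.trace_diagonal]

theorem gramStieltjes_eq_empStieltjes {p n : ℕ} (M : Matrix (Fin p) (Fin n) ℂ) {z : ℂ}
    (hz : z.im ≠ 0) :
    gramStieltjes Finset.univ M z
      = empStieltjes (fun i => (covarianceMatrix_isHermitian M).eigenvalues₀
          (Fin.cast (Fintype.card_fin n).symm i)) z := by
  unfold gramStieltjes empStieltjes
  rw [← covarianceMatrix_eq_rowGram, trace_resolventMatrix (covarianceMatrix_isHermitian M) hz]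
  congr 1
  refine Fintype.sum_equiv (((Fintype.equivOfCardEq (Fintype.card_fin (Fintype.card (Fin n)))).symm).trans
    (finCongr (Fintype.card_fin n))) _ _ fun i => ?_
  simp [Matrix.IsHermitian.eigenvalues]

end RowGram

/-! ### Bounded differences on product spaces -/

section ProductMeasure

variable {E : Type*} [MeasurableSpace E]

theorem lintegral_pi_insertNth {n : ℕ} (ν : Fin (n + 1) → Measure E)
    [∀ i, IsProbabilityMeasure (ν i)] (i : Fin (n + 1)) {f : (Fin (n + 1) → E) → ENNReal}
    (hf : Measurable f) :
    ∫⁻ x, f x ∂Measure.pi ν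
      = ∫⁻ y, ∫⁻ t, f (i.insertNth t y) ∂ν i ∂Measure.pi fun j => ν (i.succAbove j) := by
  have h := (measurePreserving_piFinSuccAbove ν i).symm
  rw [← h.lintegral_comp hf, lintegral_prod_symm']
  · rfl
  · exact hf.comp (MeasurableEquiv.measurable _)

theorem measurable_insertNth {n : ℕ} (i : Fin (n + 1)) :
    Measurable fun q : E × (Fin n → E) => (i.insertNth q.1 q.2 : Fin (n + 1) → E) :=
  (MeasurableEquiv.piFinSuccAbove (fun _ => E) i).symm.measurable

theorem lintegral_pi_le_of_update {p : ℕ} (ν : Fin p → Measure E)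
    [∀ i, IsProbabilityMeasure (ν i)] (i : Fin p) {f : (Fin p → E) → ENNReal} (hf : Measurable f)
    {c : ENNReal} (h : ∀ x, ∫⁻ t, f (Function.update x i t) ∂ν i ≤ c) :
    ∫⁻ x, f x ∂Measure.pi ν ≤ c := by
  cases p with
  | zero => exact i.elim0
  | succ p =>
    obtain ⟨t₀⟩ : Nonempty E := (ν i).nonempty_of_neZero
    rw [lintegral_pi_insertNth ν i hf]
    refine (lintegral_mono fun y => ?_).trans (by simp : ∫⁻ _, c ∂_ ≤ c)
    have := h (i.insertNth t₀ y)
    simpa using this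

/-- Exponential moment bound behind McDiarmid's inequality. -/
theorem lintegral_exp_sub_integral_le {p : ℕ} (ν : Fin p → Measure E)
    [∀ i, IsProbabilityMeasure (ν i)] {f : (Fin p → E) → ℝ} (hf : Measurable f) {b c : ℝ}
    (hb : ∀ x, |f x| ≤ b) (hc : ∀ x i t, |f (Function.update x i t) - f x| ≤ c) :
    ∫⁻ x, ENNReal.ofReal (Real.exp (f x - ∫ x', f x' ∂Measure.pi ν)) ∂Measure.pi ν
      ≤ ENNReal.ofReal (Real.exp (p * (c ^ 2 / 2))) := by
  induction p with
  | zero =>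
    have h : ∀ x, f x = f default := fun x => congrArg f (Subsingleton.elim _ _)
    simp [h]
  | succ p ih =>
    obtain ⟨t₀⟩ : Nonempty E := (ν 0).nonempty_of_neZero
    set π' := Measure.pi fun j : Fin p => ν ((0 : Fin (p + 1)).succAbove j) with hπ'
    set F : E → (Fin p → E) → ℝ := fun t y => f ((0 : Fin (p + 1)).insertNth t y) with hF
    have hFm : Measurable fun q : E × (Fin p → E) => F q.1 q.2 := hf.comp (measurable_insertNth 0)
    have hFm' : Measurable fun q : (Fin p → E) × E => F q.2 q.1 := hFm.comp measurable_swap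
    -- Averaging out coordinate 0 preserves both the uniform bound and the bounded differences, so
    -- the induction hypothesis applies to `g`.
    set g : (Fin p → E) → ℝ := fun y => ∫ t, F t y ∂ν 0 with hg
    have hgm : Measurable g := hFm'.stronglyMeasurable.integral_prod_right'.measurable
    have hFi : ∀ y, Integrable (fun t => F t y) (ν 0) := fun y =>
      Integrable.of_bound (hFm.comp (measurable_id.prodMk measurable_const)).aestronglyMeasurable b
        (.of_forall fun t => hb _)
    have hgb : ∀ y, |g y| ≤ b := fun y => by
      have := norm_integral_le_of_norm_le_const (μ := ν 0) (f := fun t => F t y) (C := b)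
        (.of_forall fun t => hb _)
      simpa using this
    have hupd : ∀ y i t t', F t' (Function.update y i t)
        = f (Function.update ((0 : Fin (p + 1)).insertNth t' y) i.succ t) := fun y i t t' => by
      simp [hF, Fin.insertNth_zero']
    have hgc : ∀ y i t, |g (Function.update y i t) - g y| ≤ c := fun y i t => by
      rw [hg]
      simp only
      rw [← integral_sub (hFi _) (hFi _)]
      have := norm_integral_le_of_norm_le_const (μ := ν 0)
        (f := fun t' => F t' (Function.update y i t) - F t' y) (C := c)
        (.of_forall fun t' => by rw [hupd]; exact hc _ _ _)
      simpa using this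
    have hint : ∫ x', f x' ∂Measure.pi ν = ∫ y, g y ∂π' := by
      have h := (measurePreserving_piFinSuccAbove ν 0).symm
      rw [← h.integral_comp', integral_prod_symm]
      · rfl
      · exact Integrable.of_bound hFm.aestronglyMeasurable b (.of_forall fun q => hb _)
    have hinner : ∀ y, ∫⁻ t, ENNReal.ofReal (Real.exp (F t y - g y)) ∂ν 0
        ≤ ENNReal.ofReal (Real.exp (c ^ 2 / 2)) := fun y => by
      have hm : Measurable fun t => F t y := hFm.comp (measurable_id.prodMk measurable_const)
      -- Hoeffding's lemma in the averaged coordinate: the values lie within c of the one at `t₀`,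
      -- an interval of length 2c, which gives variance proxy c².
      have h1 := hasSubgaussianMGF_of_mem_Icc (μ := ν 0) (X := fun t => F t y)
        (a := F t₀ y - c) (b := F t₀ y + c) hm.aemeasurable (.of_forall fun t => by
          have e : F t y = f (Function.update ((0 : Fin (p + 1)).insertNth t₀ y) 0 t) := by
            simp [hF]
          have := abs_le.1 (hc ((0 : Fin (p + 1)).insertNth t₀ y) 0 t)
          rw [← e] at this
          constructor <;> simp only [hF] at this ⊢ <;> linarith)
      have h2 := h1.mgf_le 1
      have h3 := h1.integrable_exp_mul 1
      simp only [one_mul, mgf] at h2 h3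
      rw [← ofReal_integral_eq_lintegral_ofReal h3 (.of_forall fun t => (Real.exp_pos _).le)]
      refine ENNReal.ofReal_le_ofReal (h2.trans (le_of_eq ?_))
      congr 1
      push_cast
      rw [Real.norm_eq_abs, div_pow, sq_abs]
      ring
    rw [lintegral_pi_insertNth ν 0 (by fun_prop), hint]
    calc ∫⁻ y, ∫⁻ t, ENNReal.ofReal (Real.exp (F t y - ∫ y, g y ∂π')) ∂ν 0 ∂π'
        = ∫⁻ y, (∫⁻ t, ENNReal.ofReal (Real.exp (F t y - g y)) ∂ν 0)
            * ENNReal.ofReal (Real.exp (g y - ∫ y, g y ∂π')) ∂π' := by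
          refine lintegral_congr fun y => ?_
          rw [← lintegral_mul_const']
          · refine lintegral_congr fun t => ?_
            rw [← ENNReal.ofReal_mul (Real.exp_pos _).le, ← Real.exp_add]
            congr 2
            ring
          · exact ENNReal.ofReal_ne_top
      _ ≤ ∫⁻ y, ENNReal.ofReal (Real.exp (c ^ 2 / 2))
            * ENNReal.ofReal (Real.exp (g y - ∫ y, g y ∂π')) ∂π' :=
          lintegral_mono fun y => by gcongr; exact hinner y
      _ = ENNReal.ofReal (Real.exp (c ^ 2 / 2))
            * ∫⁻ y, ENNReal.ofReal (Real.exp (g y - ∫ y, g y ∂π')) ∂π' :=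
          lintegral_const_mul' _ _ ENNReal.ofReal_ne_top
      _ ≤ ENNReal.ofReal (Real.exp (c ^ 2 / 2))
            * ENNReal.ofReal (Real.exp (p * (c ^ 2 / 2))) := by
          gcongr
          exact ih (fun j => ν ((0 : Fin (p + 1)).succAbove j)) hgm hgb hgc
      _ = _ := by
          rw [← ENNReal.ofReal_mul (Real.exp_pos _).le, ← Real.exp_add]
          congr 2
          push_cast
          ring

/-- **McDiarmid's bounded differences inequality**, with a free exponential parameter `s`. -/
theorem measure_integral_add_le_le_exp {p : ℕ} (ν : Fin p → Measure E)
    [∀ i, IsProbabilityMeasure (ν i)] {f : (Fin p → E) → ℝ} (hf : Measurable f) {b c : ℝ}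
    (hb : ∀ x, |f x| ≤ b) (hc : ∀ x i t, |f (Function.update x i t) - f x| ≤ c) {s : ℝ}
    (hs : 0 ≤ s) (u : ℝ) :
    Measure.pi ν {x | ∫ x', f x' ∂Measure.pi ν + u ≤ f x}
      ≤ ENNReal.ofReal (Real.exp (-(s * u) + p * ((s * c) ^ 2 / 2))) := by
  have h := lintegral_exp_sub_integral_le ν (f := fun x => s * f x) (hf.const_mul s)
    (b := s * b) (c := s * c)
    (fun x => by rw [abs_mul, abs_of_nonneg hs]; gcongr; exact hb x)
    (fun x i t => by rw [← mul_sub, abs_mul, abs_of_nonneg hs]; gcongr; exact hc x i t)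
  rw [integral_const_mul] at h
  set I := ∫ x', f x' ∂Measure.pi ν
  have hm := meas_ge_le_lintegral_div (μ := Measure.pi ν)
    (f := fun x => ENNReal.ofReal (Real.exp (s * f x - s * I))) (by fun_prop)
    (ε := ENNReal.ofReal (Real.exp (s * u))) (by simp [Real.exp_pos]) ENNReal.ofReal_ne_top
  calc Measure.pi ν {x | I + u ≤ f x}
      ≤ Measure.pi ν {x | ENNReal.ofReal (Real.exp (s * u))
          ≤ ENNReal.ofReal (Real.exp (s * f x - s * I))} := by
        refine measure_mono fun x hx => ?_
        simp only [Set.mem_ofPred_eq] at hx ⊢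
        gcongr
        nlinarith
    _ ≤ _ := hm
    _ ≤ ENNReal.ofReal (Real.exp (p * ((s * c) ^ 2 / 2))) / ENNReal.ofReal (Real.exp (s * u)) := by
        gcongr
    _ = _ := by
        rw [← ENNReal.ofReal_div_of_pos (Real.exp_pos _), ← Real.exp_sub]
        congr 2
        ring

end ProductMeasure

/-! ### Quadratic forms in independent variables -/

section QuadraticForm

theorem lintegral_norm_const_add_sq_le {E : Type*} [MeasurableSpace E] (ν : Measure E)
    [IsProbabilityMeasure ν] {g : E → ℂ} (hg : MemLp g 2 ν) (h0 : ∫ x, g x ∂ν = 0) {σ : ℝ}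
    (hσ : ∫ x, ‖g x‖ ^ 2 ∂ν ≤ σ) (a : ℂ) :
    ∫⁻ x, ENNReal.ofReal (‖a + g x‖ ^ 2) ∂ν ≤ ENNReal.ofReal (‖a‖ ^ 2 + σ) := by
  have hgi : Integrable g ν := hg.integrable one_le_two
  have hg2 : Integrable (fun x => ‖g x‖ ^ 2) ν := hg.integrable_norm_pow two_ne_zero
  have hag : MemLp (fun x => a + g x) 2 ν := (memLp_const a).add hg
  have hag2 : Integrable (fun x => ‖a + g x‖ ^ 2) ν := hag.integrable_norm_pow two_ne_zero
  rw [← ofReal_integral_eq_lintegral_ofReal hag2 (.of_forall fun x => by positivity)]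
  refine ENNReal.ofReal_le_ofReal ?_
  have hin : Integrable (fun x => 2 * (star a * g x).re) ν := ((hgi.const_mul _).re).const_mul 2
  have e : ∀ x, ‖a + g x‖ ^ 2 = ‖a‖ ^ 2 + 2 * (star a * g x).re + ‖g x‖ ^ 2 := fun x => by
    rw [← Complex.normSq_eq_norm_sq, ← Complex.normSq_eq_norm_sq, ← Complex.normSq_eq_norm_sq,
      Complex.normSq_apply, Complex.normSq_apply, Complex.normSq_apply]
    simp
    ring
  have hin' : Integrable (fun x => ‖a‖ ^ 2 + 2 * (star a * g x).re) ν :=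
    (integrable_const _).add hin
  simp_rw [e]
  rw [integral_add hin' hg2, integral_add (integrable_const _) hin,
    integral_const_mul]
  have h1 : ∫ x, (star a * g x).re ∂ν = 0 := by
    have := integral_re (hgi.const_mul (star a))
    rw [integral_const_mul, h0, mul_zero] at this
    simpa using this
  rw [h1]
  simpa using hσ

/-- Orthogonality of independent centred variables. -/
theorem lintegral_norm_sum_sq_le {E : Type*} [MeasurableSpace E] {n : ℕ} (ν : Fin n → Measure E)
    [∀ i, IsProbabilityMeasure (ν i)] {g : Fin n → E → ℂ} (hm : ∀ i, Measurable (g i))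
    (hg : ∀ i, MemLp (g i) 2 (ν i)) (h0 : ∀ i, ∫ x, g i x ∂ν i = 0) {σ : Fin n → ℝ}
    (hσ : ∀ i, ∫ x, ‖g i x‖ ^ 2 ∂ν i ≤ σ i) :
    ∫⁻ x, ENNReal.ofReal (‖∑ i, g i (x i)‖ ^ 2) ∂Measure.pi ν ≤ ENNReal.ofReal (∑ i, σ i) := by
  induction n with
  | zero => simp
  | succ n ih =>
    have hσ0 : ∀ i, 0 ≤ σ i := fun i => (integral_nonneg fun x => by positivity).trans (hσ i)
    rw [lintegral_pi_insertNth ν 0 (by fun_prop)]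
    calc _ ≤ ∫⁻ y : Fin n → E, (ENNReal.ofReal (‖∑ i, g (Fin.succ i) (y i)‖ ^ 2)
            + ENNReal.ofReal (σ 0)) ∂Measure.pi fun j => ν (Fin.succAbove 0 j) := by
          refine lintegral_mono fun y => ?_
          rw [← ENNReal.ofReal_add (by positivity) (hσ0 0)]
          refine le_trans (le_of_eq ?_)
            (lintegral_norm_const_add_sq_le (ν 0) (hg 0) (h0 0) (hσ 0) _)
          refine lintegral_congr fun t => ?_
          rw [Fin.sum_univ_succ, add_comm]
          simp
      _ = (∫⁻ y : Fin n → E, ENNReal.ofReal (‖∑ i, g (Fin.succ i) (y i)‖ ^ 2)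
            ∂Measure.pi fun j => ν (Fin.succAbove 0 j)) + ENNReal.ofReal (σ 0) := by
          rw [lintegral_add_right _ measurable_const]
          simp
      _ ≤ ENNReal.ofReal (∑ i : Fin n, σ i.succ) + ENNReal.ofReal (σ 0) := by
          gcongr
          exact ih (fun j => ν (Fin.succAbove 0 j)) (fun i => hm _) (fun i => hg _)
            (fun i => h0 _) (fun i => hσ _)
      _ = _ := by
          rw [← ENNReal.ofReal_add (Finset.sum_nonneg fun i _ => hσ0 _) (hσ0 0),
            Fin.sum_univ_succ, add_comm]

/-- The off-diagonal part of the sesquilinear form `∑ⱼₖ Aⱼₖ xⱼ conj xₖ`. -/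
noncomputable def offDiagForm {n : ℕ} (A : Matrix (Fin n) (Fin n) ℂ) (x : Fin n → ℂ) : ℂ :=
  ∑ j, ∑ k, if j = k then 0 else A j k * x j * star (x k)

theorem measurable_offDiagForm {n : ℕ} (A : Matrix (Fin n) (Fin n) ℂ) :
    Measurable (offDiagForm A) := by
  unfold offDiagForm
  refine Finset.measurable_sum _ fun j _ => Finset.measurable_sum _ fun k _ => ?_
  split_ifs
  · fun_prop
  · simp only [RCLike.star_def]; fun_prop

/-- Since the diagonal is absent, isolating one variable t leaves no |t|² term: the increment is
linear in t and its conjugate, hence centred given the other variables. -/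
theorem offDiagForm_cons {n : ℕ} (A : Matrix (Fin (n + 1)) (Fin (n + 1)) ℂ) (t : ℂ)
    (y : Fin n → ℂ) :
    offDiagForm A ((0 : Fin (n + 1)).insertNth t y)
      = offDiagForm (A.submatrix Fin.succ Fin.succ) y
        + (t * (∑ k, A 0 (Fin.succ k) * star (y k)) + star t * ∑ j, A (Fin.succ j) 0 * y j) := by
  unfold offDiagForm
  simp only [Fin.sum_univ_succ, Fin.insertNth_zero', Fin.cons_zero, Fin.cons_succ,
    Fin.succ_ne_zero, Fin.succ_inj, if_true, if_false, Matrix.submatrix_apply, zero_add,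
    (Fin.succ_ne_zero _).symm, Finset.sum_add_distrib, Finset.mul_sum]
  have h1 : ∀ j : Fin n, A j.succ 0 * y j * star t = star t * (A j.succ 0 * y j) := fun j => by ring
  have h2 : ∀ j : Fin n, A 0 j.succ * t * star (y j) = t * (A 0 j.succ * star (y j)) :=
    fun j => by ring
  simp_rw [h1, h2]
  ring

/-- The conditions on the law of an entry: centred with unit variance. -/
structure IsStandardized (ν : Measure ℂ) : Prop where
  memLp : MemLp id 2 ν
  integral_eq_zero : ∫ x, x ∂ν = 0
  integral_norm_sq : ∫ x, ‖x‖ ^ 2 ∂ν = 1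

theorem IsStandardized.star {ν : Measure ℂ} (h : IsStandardized ν) :
    MemLp (fun x : ℂ => star x) 2 ν ∧ ∫ x, star x ∂ν = 0 :=
  ⟨h.memLp.star, by
    have := integral_conj (μ := ν) (f := fun x : ℂ => x)
    simp only [RCLike.star_def]
    rw [this, h.integral_eq_zero, map_zero]⟩

/-- Peel off one variable at a time: the centred increment t U + conj t · V is orthogonal to the
rest, and U, V are linear forms whose second moments are bounded by the row and column sums of |A j
k|². The factor 2 comes from (|U| + |V|)² ≤ 2|U|² + 2|V|², as E t² need not vanish. -/
theorem lintegral_norm_offDiagForm_sq_le {n : ℕ} (ν : Fin n → Measure ℂ)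
    [∀ i, IsProbabilityMeasure (ν i)] (hν : ∀ i, IsStandardized (ν i))
    (A : Matrix (Fin n) (Fin n) ℂ) :
    ∫⁻ x, ENNReal.ofReal (‖offDiagForm A x‖ ^ 2) ∂Measure.pi ν
      ≤ ENNReal.ofReal (2 * ∑ j, ∑ k, ‖A j k‖ ^ 2) := by
  induction n with
  | zero => simp [offDiagForm]
  | succ n ih =>
    have hmeas := measurable_offDiagForm A
    rw [lintegral_pi_insertNth ν 0 (by fun_prop)]
    set π' := Measure.pi fun j => ν ((0 : Fin (n + 1)).succAbove j) with hπ'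
    set A' := A.submatrix Fin.succ Fin.succ with hA'
    have hmeas' := measurable_offDiagForm A'
    set U : (Fin n → ℂ) → ℂ := fun y => ∑ k, A 0 (Fin.succ k) * star (y k) with hU
    set V : (Fin n → ℂ) → ℂ := fun y => ∑ j, A (Fin.succ j) 0 * y j with hV
    have hUm : Measurable U := by
      simp only [hU, RCLike.star_def]; fun_prop
    have hVm : Measurable V := by fun_prop
    have hlin : ∀ (a : ℂ) i, ∫ x, ‖a * x‖ ^ 2 ∂ν i ≤ ‖a‖ ^ 2 := fun a i => by
      simp_rw [norm_mul, mul_pow]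
      rw [integral_const_mul, (hν i).integral_norm_sq, mul_one]
    have hUb : ∫⁻ y, ENNReal.ofReal (‖U y‖ ^ 2) ∂π'
        ≤ ENNReal.ofReal (∑ k, ‖A 0 (Fin.succ k)‖ ^ 2) := by
      refine lintegral_norm_sum_sq_le (fun j => ν ((0 : Fin (n + 1)).succAbove j))
        (g := fun k x => A 0 (Fin.succ k) * star x)
        (fun k => by simp only [RCLike.star_def]; fun_prop)
        (fun k => (hν _).star.1.const_mul _)
        (fun k => by rw [integral_const_mul, (hν _).star.2, mul_zero])
        (fun k => by simpa using hlin (A 0 (Fin.succ k)) ((0 : Fin (n + 1)).succAbove k))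
    have hVb : ∫⁻ y, ENNReal.ofReal (‖V y‖ ^ 2) ∂π'
        ≤ ENNReal.ofReal (∑ j, ‖A (Fin.succ j) 0‖ ^ 2) := by
      refine lintegral_norm_sum_sq_le (fun j => ν ((0 : Fin (n + 1)).succAbove j))
        (g := fun k x => A (Fin.succ k) 0 * x)
        (fun k => by fun_prop)
        (fun k => (hν _).memLp.const_mul _)
        (fun k => by rw [integral_const_mul, (hν _).integral_eq_zero, mul_zero])
        (fun k => hlin (A (Fin.succ k) 0) ((0 : Fin (n + 1)).succAbove k))
    have hinner : ∀ y, ∫⁻ t, ENNReal.ofReal (‖offDiagForm A ((0 : Fin (n + 1)).insertNth t y)‖ ^ 2)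
          ∂ν 0 ≤ ENNReal.ofReal (‖offDiagForm A' y‖ ^ 2)
            + (2 * ENNReal.ofReal (‖U y‖ ^ 2) + 2 * ENNReal.ofReal (‖V y‖ ^ 2)) := fun y => by
      simp_rw [offDiagForm_cons]
      have hL1 : MemLp (fun t : ℂ => t * U y) 2 (ν 0) := (hν 0).memLp.mul_const _
      have hL2 : MemLp (fun t : ℂ => star t * V y) 2 (ν 0) := (hν 0).star.1.mul_const _
      refine (lintegral_norm_const_add_sq_le (ν 0) (g := fun t => t * U y + star t * V y)
        (σ := 2 * ‖U y‖ ^ 2 + 2 * ‖V y‖ ^ 2) (hL1.add hL2) ?_ ?_ _).trans (le_of_eq ?_)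
      · rw [integral_add (hL1.integrable one_le_two) (hL2.integrable one_le_two),
          integral_mul_const, integral_mul_const, (hν 0).integral_eq_zero, (hν 0).star.2]
        simp
      · have hi : Integrable (fun t : ℂ => ‖t‖ ^ 2) (ν 0) :=
          (hν 0).memLp.integrable_norm_pow two_ne_zero
        calc ∫ t, ‖t * U y + star t * V y‖ ^ 2 ∂ν 0
            ≤ ∫ t, ‖t‖ ^ 2 * (2 * ‖U y‖ ^ 2 + 2 * ‖V y‖ ^ 2) ∂ν 0 := by
              refine integral_mono ((hL1.add hL2).integrable_norm_pow two_ne_zero)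
                (hi.mul_const _) fun t => ?_
              have h1 : ‖t * U y + star t * V y‖ ≤ ‖t‖ * (‖U y‖ + ‖V y‖) := by
                refine (norm_add_le _ _).trans (le_of_eq ?_)
                rw [norm_mul, norm_mul, norm_star]; ring
              calc ‖t * U y + star t * V y‖ ^ 2 ≤ (‖t‖ * (‖U y‖ + ‖V y‖)) ^ 2 := by gcongr
                _ = ‖t‖ ^ 2 * (‖U y‖ + ‖V y‖) ^ 2 := mul_pow _ _ _
                _ ≤ _ := by
                  gcongr
                  nlinarith [sq_nonneg (‖U y‖ - ‖V y‖)]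
          _ = _ := by rw [integral_mul_const, (hν 0).integral_norm_sq, one_mul]
      · rw [ENNReal.ofReal_add (by positivity) (by positivity),
          ENNReal.ofReal_add (by positivity) (by positivity), ENNReal.ofReal_mul zero_le_two,
          ENNReal.ofReal_mul zero_le_two]
        simp [hA']
    calc _ ≤ ∫⁻ y, (ENNReal.ofReal (‖offDiagForm A' y‖ ^ 2)
            + (2 * ENNReal.ofReal (‖U y‖ ^ 2) + 2 * ENNReal.ofReal (‖V y‖ ^ 2))) ∂π' :=
          lintegral_mono hinner
      _ = ∫⁻ y, ENNReal.ofReal (‖offDiagForm A' y‖ ^ 2) ∂π'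
            + (2 * ∫⁻ y, ENNReal.ofReal (‖U y‖ ^ 2) ∂π'
              + 2 * ∫⁻ y, ENNReal.ofReal (‖V y‖ ^ 2) ∂π') := by
          rw [lintegral_add_left (by fun_prop), lintegral_add_left (by fun_prop),
            lintegral_const_mul _ (by fun_prop), lintegral_const_mul _ (by fun_prop)]
      _ ≤ ENNReal.ofReal (2 * ∑ j, ∑ k, ‖A' j k‖ ^ 2)
            + (2 * ENNReal.ofReal (∑ k, ‖A 0 (Fin.succ k)‖ ^ 2)
              + 2 * ENNReal.ofReal (∑ j, ‖A (Fin.succ j) 0‖ ^ 2)) := by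
          gcongr
          exact ih (fun j => ν ((0 : Fin (n + 1)).succAbove j)) (fun i => hν _) A'
      _ = ENNReal.ofReal (2 * ∑ j, ∑ k, ‖A' j k‖ ^ 2
            + (2 * (∑ k, ‖A 0 (Fin.succ k)‖ ^ 2) + 2 * (∑ j, ‖A (Fin.succ j) 0‖ ^ 2))) := by
          rw [ENNReal.ofReal_add (by positivity) (by positivity),
            ENNReal.ofReal_add (by positivity) (by positivity), ENNReal.ofReal_mul zero_le_two,
            ENNReal.ofReal_mul zero_le_two, ENNReal.ofReal_mul zero_le_two]
          simp
      _ ≤ _ := by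
          refine ENNReal.ofReal_le_ofReal ?_
          simp only [Fin.sum_univ_succ, Finset.sum_add_distrib, hA', Matrix.submatrix_apply]
          nlinarith [sq_nonneg ‖A 0 0‖]

end QuadraticForm

/-! ### Truncation of the diagonal part -/

section QuadraticForm

/-- From second to first moments by f ≤ α/2 + f²/(2α), with α free to be tuned later. -/
theorem lintegral_ofReal_le_of_sq {Ω : Type*} [MeasurableSpace Ω] (μ : Measure Ω)
    [IsProbabilityMeasure μ] {f : Ω → ℝ} (hf : Measurable f) {α σ : ℝ} (hα : 0 < α) (hσ : 0 ≤ σ)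
    (h : ∫⁻ x, ENNReal.ofReal (f x ^ 2) ∂μ ≤ ENNReal.ofReal σ) :
    ∫⁻ x, ENNReal.ofReal (f x) ∂μ ≤ ENNReal.ofReal (α / 2 + σ / (2 * α)) := by
  calc ∫⁻ x, ENNReal.ofReal (f x) ∂μ
      ≤ ∫⁻ x, (ENNReal.ofReal (α / 2) + ENNReal.ofReal (1 / (2 * α)) * ENNReal.ofReal (f x ^ 2)) ∂μ := by
        refine lintegral_mono fun x => ?_
        rw [← ENNReal.ofReal_mul (by positivity), ← ENNReal.ofReal_add (by positivity) (by positivity)]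
        refine ENNReal.ofReal_le_ofReal ?_
        have : α / 2 + 1 / (2 * α) * f x ^ 2 - f x = (f x - α) ^ 2 / (2 * α) := by
          field_simp
          ring
        have h2 : 0 ≤ (f x - α) ^ 2 / (2 * α) := by positivity
        linarith
    _ = ENNReal.ofReal (α / 2) + ENNReal.ofReal (1 / (2 * α)) * ∫⁻ x, ENNReal.ofReal (f x ^ 2) ∂μ := by
        rw [lintegral_add_left measurable_const, lintegral_const_mul _ (by fun_prop)]
        simp
    _ ≤ ENNReal.ofReal (α / 2) + ENNReal.ofReal (1 / (2 * α)) * ENNReal.ofReal σ := by gcongr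
    _ = _ := by
        rw [← ENNReal.ofReal_mul (by positivity), ← ENNReal.ofReal_add (by positivity) (by positivity)]
        congr 2
        ring

theorem lintegral_pi_eval {E : Type*} [MeasurableSpace E] {n : ℕ} (ν : Fin n → Measure E)
    [∀ i, IsProbabilityMeasure (ν i)] (i : Fin n) {f : E → ENNReal} (hf : Measurable f) :
    ∫⁻ x, f (x i) ∂Measure.pi ν = ∫⁻ t, f t ∂ν i :=
  (measurePreserving_eval ν i).lintegral_comp hf

/-- The second moment of `ν` carried by `{|x|² > T}`. -/
noncomputable def tailMoment (ν : Measure ℂ) (T : ℝ) : ℝ :=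
  ∫ x, (if T < ‖x‖ ^ 2 then ‖x‖ ^ 2 else 0) ∂ν

/-- Fourth moments may be infinite or too large, so |x|² is truncated at T. The truncated part has
variance at most T because its mean is at most 1, and is handled in L²; the tail and the recentring
cost at most 2τ in L¹. -/
theorem lintegral_norm_diag_le {n : ℕ} (ν : Fin n → Measure ℂ)
    [∀ i, IsProbabilityMeasure (ν i)] (hν : ∀ i, IsStandardized (ν i))
    (d : Fin n → ℂ) {B T τ α : ℝ} (hB : 0 ≤ B) (hT : 0 ≤ T) (hα : 0 < α) (hd : ∀ i, ‖d i‖ ≤ B)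
    (hτ : ∀ i, tailMoment (ν i) T ≤ τ) :
    ∫⁻ x, ENNReal.ofReal ‖∑ j, d j * ((‖x j‖ ^ 2 - 1 : ℝ) : ℂ)‖ ∂Measure.pi ν
      ≤ ENNReal.ofReal (α / 2 + n * (B ^ 2 * T) / (2 * α) + n * (B * (2 * τ))) := by
  set lo : ℂ → ℝ := fun x => if T < ‖x‖ ^ 2 then 0 else ‖x‖ ^ 2 with hlo
  set hi : ℂ → ℝ := fun x => if T < ‖x‖ ^ 2 then ‖x‖ ^ 2 else 0 with hhi
  have hset : MeasurableSet {x : ℂ | T < ‖x‖ ^ 2} :=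
    measurableSet_lt measurable_const (by fun_prop)
  have hlom : Measurable lo := Measurable.ite hset measurable_const (by fun_prop)
  have hhim : Measurable hi := Measurable.ite hset (by fun_prop) measurable_const
  have hlo0 : ∀ x, 0 ≤ lo x := fun x => by simp only [hlo]; split_ifs <;> positivity
  have hhi0 : ∀ x, 0 ≤ hi x := fun x => by simp only [hhi]; split_ifs <;> positivity
  have hloT : ∀ x, lo x ≤ T := fun x => by
    simp only [hlo]; split_ifs with h
    · exact hT
    · exact not_lt.1 h
  have hsum : ∀ x, lo x + hi x = ‖x‖ ^ 2 := fun x => by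
    simp only [hlo, hhi]; split_ifs <;> simp
  have hi2 : ∀ i, Integrable (fun x : ℂ => ‖x‖ ^ 2) (ν i) := fun i =>
    (hν i).memLp.integrable_norm_pow two_ne_zero
  have hloi : ∀ i, Integrable lo (ν i) := fun i =>
    (hi2 i).mono' hlom.aestronglyMeasurable (.of_forall fun x => by
      rw [Real.norm_eq_abs, abs_of_nonneg (hlo0 x), ← hsum]; linarith [hhi0 x])
  have hhii : ∀ i, Integrable hi (ν i) := fun i =>
    (hi2 i).mono' hhim.aestronglyMeasurable (.of_forall fun x => by
      rw [Real.norm_eq_abs, abs_of_nonneg (hhi0 x), ← hsum]; linarith [hlo0 x])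
  set e : Fin n → ℝ := fun i => ∫ x, lo x ∂ν i with he
  have he1 : ∀ i, e i + tailMoment (ν i) T = 1 := fun i => by
    rw [← (hν i).integral_norm_sq, tailMoment, he, ← integral_add (hloi i) (hhii i)]
    simp_rw [hsum]
  have he0 : ∀ i, 0 ≤ e i := fun i => integral_nonneg hlo0
  -- the truncated and centred part
  have hcen : ∀ i, ∫ x, ‖d i * ((lo x - e i : ℝ) : ℂ)‖ ^ 2 ∂ν i ≤ B ^ 2 * T := fun i => by
    have hb : Integrable (fun x => (lo x - e i) ^ 2) (ν i) := by
      refine Integrable.of_bound (by fun_prop) ((T + e i) ^ 2) (.of_forall fun x => ?_)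
      rw [Real.norm_eq_abs, abs_of_nonneg (sq_nonneg _)]
      nlinarith [hlo0 x, hloT x, he0 i]
    have hsq : ∫ x, (lo x - e i) ^ 2 ∂ν i ≤ T := by
      have hle : ∀ x, (lo x - e i) ^ 2 ≤ T * lo x - 2 * e i * lo x + e i ^ 2 := fun x => by
        nlinarith [hlo0 x, hloT x]
      have hle1 : e i ≤ 1 := by
        have : 0 ≤ tailMoment (ν i) T := integral_nonneg hhi0
        linarith [he1 i]
      have hint : Integrable (fun x => T * lo x - 2 * e i * lo x) (ν i) :=
        ((hloi i).const_mul _).sub ((hloi i).const_mul _)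
      calc ∫ x, (lo x - e i) ^ 2 ∂ν i ≤ ∫ x, T * lo x - 2 * e i * lo x + e i ^ 2 ∂ν i :=
            integral_mono hb (hint.add (integrable_const _)) hle
        _ = T * e i - 2 * e i * e i + e i ^ 2 := by
            rw [integral_add hint (integrable_const _), integral_sub ((hloi i).const_mul _)
              ((hloi i).const_mul _), integral_const_mul, integral_const_mul]
            simp [he]
        _ ≤ T := by nlinarith [he0 i, sq_nonneg (e i)]
    have hfun : ∀ x, ‖d i * ((lo x - e i : ℝ) : ℂ)‖ ^ 2 = ‖d i‖ ^ 2 * (lo x - e i) ^ 2 := fun x => by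
      rw [norm_mul, mul_pow, Complex.norm_real, Real.norm_eq_abs, sq_abs]
    simp_rw [hfun]
    rw [integral_const_mul]
    have := hd i
    gcongr
  have hLp : ∀ i, MemLp (fun x => d i * ((lo x - e i : ℝ) : ℂ)) 2 (ν i) := fun i => by
    refine MemLp.of_bound (by fun_prop) (B * (T + e i)) (.of_forall fun x => ?_)
    rw [norm_mul, Complex.norm_real, Real.norm_eq_abs]
    gcongr
    · exact hd i
    · rw [abs_le]; constructor <;> linarith [hlo0 x, hloT x, he0 i]
  have hzero : ∀ i, ∫ x, d i * ((lo x - e i : ℝ) : ℂ) ∂ν i = 0 := fun i => by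
    rw [integral_const_mul, integral_complex_ofReal, integral_sub (hloi i) (integrable_const _)]
    simp [he]
  have hA := lintegral_norm_sum_sq_le ν (g := fun i x => d i * ((lo x - e i : ℝ) : ℂ))
    (fun i => by fun_prop) hLp hzero hcen
  have hA' := lintegral_ofReal_le_of_sq (Measure.pi ν)
    (f := fun x : Fin n → ℂ => ‖∑ i, d i * ((lo (x i) - e i : ℝ) : ℂ)‖)
    (by fun_prop) hα (Finset.sum_nonneg fun i _ => by positivity) hA
  -- the tail part
  have hrest : ∀ i, ∫⁻ x, ENNReal.ofReal (B * (hi x + (1 - e i))) ∂ν i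
      ≤ ENNReal.ofReal (B * (2 * τ)) := fun i => by
    have h1e : 0 ≤ 1 - e i := by
      have : 0 ≤ tailMoment (ν i) T := integral_nonneg hhi0
      linarith [he1 i]
    have hint : Integrable (fun x => B * (hi x + (1 - e i))) (ν i) :=
      ((hhii i).add (integrable_const _)).const_mul _
    rw [← ofReal_integral_eq_lintegral_ofReal hint
      (.of_forall fun x => mul_nonneg hB (add_nonneg (hhi0 x) h1e))]
    refine ENNReal.ofReal_le_ofReal ?_
    rw [integral_const_mul, integral_add (hhii i) (integrable_const _)]
    have h1 : ∫ x, hi x ∂ν i = tailMoment (ν i) T := rfl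
    rw [h1]
    simp only [integral_const, probReal_univ, smul_eq_mul, one_mul]
    gcongr
    linarith [hτ i, he1 i]
  have hB' : ∫⁻ x : Fin n → ℂ, ∑ i, ENNReal.ofReal (B * (hi (x i) + (1 - e i))) ∂Measure.pi ν
      ≤ ENNReal.ofReal (n * (B * (2 * τ))) := by
    rw [lintegral_finsetSum _ fun i _ => by fun_prop]
    calc _ ≤ ∑ i : Fin n, ENNReal.ofReal (B * (2 * τ)) := by
          refine Finset.sum_le_sum fun i _ => ?_
          rw [lintegral_pi_eval ν i (f := fun t => ENNReal.ofReal (B * (hi t + (1 - e i))))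
            (by fun_prop)]
          exact hrest i
      _ = _ := by
          rw [Finset.sum_const, Finset.card_univ, Fintype.card_fin, nsmul_eq_mul,
            ENNReal.ofReal_mul (Nat.cast_nonneg n), ENNReal.ofReal_natCast]
  rcases Nat.eq_zero_or_pos n with rfl | hn
  · simp
  have hτ0 : 0 ≤ τ := (integral_nonneg hhi0).trans (hτ ⟨0, hn⟩)
  calc _ ≤ ∫⁻ x : Fin n → ℂ, (ENNReal.ofReal ‖∑ i, d i * ((lo (x i) - e i : ℝ) : ℂ)‖
          + ∑ i, ENNReal.ofReal (B * (hi (x i) + (1 - e i)))) ∂Measure.pi ν := by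
        refine lintegral_mono fun x => ?_
        have h1e : ∀ i, 0 ≤ 1 - e i := fun i => by
          have : 0 ≤ tailMoment (ν i) T := integral_nonneg hhi0
          linarith [he1 i]
        rw [← ENNReal.ofReal_sum_of_nonneg fun i _ => mul_nonneg hB (add_nonneg (hhi0 _) (h1e i)),
          ← ENNReal.ofReal_add (norm_nonneg _)
            (Finset.sum_nonneg fun i _ => mul_nonneg hB (add_nonneg (hhi0 _) (h1e i)))]
        refine ENNReal.ofReal_le_ofReal ?_
        have hdec : ∑ j, d j * ((‖x j‖ ^ 2 - 1 : ℝ) : ℂ)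
            = ∑ i, d i * ((lo (x i) - e i : ℝ) : ℂ)
              + ∑ i, d i * ((hi (x i) - (1 - e i) : ℝ) : ℂ) := by
          rw [← Finset.sum_add_distrib]
          refine Finset.sum_congr rfl fun i _ => ?_
          rw [← hsum]; push_cast; ring
        rw [hdec]
        refine (norm_add_le _ _).trans (add_le_add_right ?_ _)
        refine norm_sum_le_of_le _ fun i _ => ?_
        rw [norm_mul, Complex.norm_real, Real.norm_eq_abs]
        gcongr
        · exact hd i
        · rw [abs_le]; constructor <;> linarith [hhi0 (x i), h1e i]
    _ = _ := lintegral_add_left (by fun_prop) _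
    _ ≤ ENNReal.ofReal (α / 2 + (∑ _i : Fin n, B ^ 2 * T) / (2 * α))
          + ENNReal.ofReal (n * (B * (2 * τ))) := add_le_add hA' hB'
    _ = _ := by
        rw [← ENNReal.ofReal_add (by positivity) (by positivity)]
        simp

/-- Concentration of a quadratic form in independent standardized variables around the trace. -/
theorem lintegral_norm_quadForm_sub_trace_le {n : ℕ} (ν : Fin n → Measure ℂ)
    [∀ i, IsProbabilityMeasure (ν i)] (hν : ∀ i, IsStandardized (ν i))
    (A : Matrix (Fin n) (Fin n) ℂ) {B T τ α : ℝ} (hB : 0 ≤ B) (hT : 0 ≤ T) (hα : 0 < α)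
    (hd : ∀ i, ‖A i i‖ ≤ B) (hcol : ∀ k, ∑ j, ‖A j k‖ ^ 2 ≤ B ^ 2)
    (hτ : ∀ i, tailMoment (ν i) T ≤ τ) :
    ∫⁻ x, ENNReal.ofReal ‖x ⬝ᵥ A *ᵥ star x - A.trace‖ ∂Measure.pi ν
      ≤ ENNReal.ofReal (α + n * (B ^ 2 * (T + 2)) / (2 * α) + n * (B * (2 * τ))) := by
  rcases Nat.eq_zero_or_pos n with rfl | hn
  · simp [Matrix.trace]
  have hτ0 : 0 ≤ τ := le_trans
    (integral_nonneg fun x => by split_ifs <;> positivity) (hτ ⟨0, hn⟩)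
  have hdec : ∀ x : Fin n → ℂ, x ⬝ᵥ A *ᵥ star x - A.trace
      = offDiagForm A x + ∑ j, A j j * ((‖x j‖ ^ 2 - 1 : ℝ) : ℂ) := fun x => by
    have h1 : x ⬝ᵥ A *ᵥ star x = ∑ j, ∑ k, A j k * x j * star (x k) := by
      simp only [dotProduct, Matrix.mulVec, Finset.mul_sum, Pi.star_apply]
      exact Finset.sum_congr rfl fun j _ => Finset.sum_congr rfl fun k _ => by ring
    have h2 : ∑ j, ∑ k, A j k * x j * star (x k)
        = offDiagForm A x + ∑ j, A j j * x j * star (x j) := by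
      rw [offDiagForm, ← Finset.sum_add_distrib]
      refine Finset.sum_congr rfl fun j _ => ?_
      rw [← Finset.sum_erase_add _ _ (Finset.mem_univ j),
        ← Finset.sum_erase_add (Finset.univ : Finset (Fin n)) (fun k => if j = k then 0 else _)
          (Finset.mem_univ j), if_pos rfl, add_zero]
      congr 1
      exact Finset.sum_congr rfl fun k hk => by rw [if_neg (Finset.ne_of_mem_erase hk).symm]
    rw [h1, h2, Matrix.trace, add_sub_assoc, ← Finset.sum_sub_distrib]
    congr 1
    refine Finset.sum_congr rfl fun j _ => ?_
    rw [mul_assoc, RCLike.star_def, Complex.mul_conj']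
    simp
    ring
  have hS : 2 * ∑ j, ∑ k, ‖A j k‖ ^ 2 ≤ 2 * (n * B ^ 2) := by
    rw [Finset.sum_comm]
    gcongr
    refine (Finset.sum_le_sum fun k _ => hcol k).trans ?_
    simp
  have hoff := lintegral_ofReal_le_of_sq (Measure.pi ν) (f := fun x => ‖offDiagForm A x‖)
    (measurable_offDiagForm A).norm hα (by positivity)
    ((lintegral_norm_offDiagForm_sq_le ν hν A).trans (ENNReal.ofReal_le_ofReal hS))
  have hdiag := lintegral_norm_diag_le ν hν (fun j => A j j) hB hT hα hd hτ
  calc _ ≤ ∫⁻ x : Fin n → ℂ, (ENNReal.ofReal ‖offDiagForm A x‖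
          + ENNReal.ofReal ‖∑ j, A j j * ((‖x j‖ ^ 2 - 1 : ℝ) : ℂ)‖) ∂Measure.pi ν := by
        refine lintegral_mono fun x => ?_
        rw [hdec, ← ENNReal.ofReal_add (norm_nonneg _) (norm_nonneg _)]
        exact ENNReal.ofReal_le_ofReal (norm_add_le _ _)
    _ = _ := lintegral_add_left (measurable_offDiagForm A).norm.ennreal_ofReal _
    _ ≤ _ := add_le_add hoff hdiag
    _ = _ := by
        rw [← ENNReal.ofReal_add (by positivity) (by positivity)]
        congr 1
        ring

end QuadraticForm

/-! ### Concentration of the Marchenko–Pastur defect -/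

section GramConcentration

theorem continuous_rowGram {p n : ℕ} (s : Finset (Fin p)) :
    Continuous fun X : Fin p → Fin n → ℂ => rowGram s X := by
  refine continuous_matrix fun j k => ?_
  simp only [rowGram, Matrix.sum_apply, Matrix.smul_apply, Matrix.vecMulVec_apply, Pi.star_apply,
    star_star, smul_eq_mul, RCLike.star_def]
  fun_prop

theorem measurable_resolventMatrix_rowGram {p n : ℕ} (s : Finset (Fin p)) (z : ℂ) (j k : Fin n) :
    Measurable fun X : Fin p → Fin n → ℂ => resolventMatrix (rowGram s X) z j k := by
  have hc : Continuous fun X : Fin p → Fin n → ℂ =>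
      rowGram s X - z • (1 : Matrix (Fin n) (Fin n) ℂ) := (continuous_rowGram s).sub continuous_const
  simp only [resolventMatrix, Matrix.inv_def, Matrix.smul_apply, Ring.inverse_eq_inv', smul_eq_mul]
  exact hc.matrix_det.measurable.inv.mul (hc.matrix_adjugate.matrix_elem j k).measurable

theorem measurable_gramStieltjes {p n : ℕ} (s : Finset (Fin p)) (z : ℂ) :
    Measurable fun X : Fin p → Fin n → ℂ => gramStieltjes s X z := by
  unfold gramStieltjes Matrix.trace
  exact (Finset.measurable_sum _ fun i _ =>
    measurable_resolventMatrix_rowGram s z i i).const_mul _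

theorem measurable_rowQuadForm {p n : ℕ} (z : ℂ) (i : Fin p) :
    Measurable fun X : Fin p → Fin n → ℂ => rowQuadForm X z i := by
  unfold rowQuadForm dotProduct Matrix.mulVec dotProduct
  refine (Finset.measurable_sum _ fun j _ => ?_).const_mul _
  refine Measurable.mul (by fun_prop) (Finset.measurable_sum _ fun k _ => ?_)
  refine (measurable_resolventMatrix_rowGram _ z j k).mul ?_
  simp only [Pi.star_apply, RCLike.star_def]
  fun_prop

theorem measurable_mpDefect (y : ℝ) (z : ℂ) : Measurable (mpDefect y z) := by
  unfold mpDefect; fun_prop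

/-- Freeze all rows but the i-th: the resolvent of the others is then a constant matrix, and the
quadratic form estimate applies with B = 1/Im z. Its parameter is α = nβ, to match the normalisation
1/n. -/
theorem lintegral_rowQuadForm_sub_le {p n : ℕ} (hn : 0 < n) (ν : Fin p → Fin n → Measure ℂ)
    [∀ i j, IsProbabilityMeasure (ν i j)] (hν : ∀ i j, IsStandardized (ν i j)) {z : ℂ}
    (hz : 0 < z.im) {T τ β : ℝ} (hT : 0 ≤ T) (hβ : 0 < β)
    (hτ : ∀ i j, tailMoment (ν i j) T ≤ τ) (i : Fin p) :
    ∫⁻ X, ENNReal.ofReal ‖rowQuadForm X z i - gramStieltjes (Finset.univ.erase i) X z‖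
        ∂Measure.pi (fun i => Measure.pi (ν i))
      ≤ ENNReal.ofReal (β + (z.im⁻¹) ^ 2 * (T + 2) / (2 * β * n) + z.im⁻¹ * (2 * τ)) := by
  have hn' : (0 : ℝ) < n := by exact_mod_cast hn
  refine lintegral_pi_le_of_update (fun i => Measure.pi (ν i)) i
    (((measurable_rowQuadForm z i).sub (measurable_gramStieltjes _ z)).norm.ennreal_ofReal)
    fun X => ?_
  set R := resolventMatrix (rowGram (Finset.univ.erase i) X) z with hR
  have hH := rowGram_isHermitian (Finset.univ.erase i) X
  have e : ∀ t : Fin n → ℂ, ENNReal.ofReal ‖rowQuadForm (Function.update X i t) z i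
      - gramStieltjes (Finset.univ.erase i) (Function.update X i t) z‖
      = ENNReal.ofReal (n : ℝ)⁻¹ * ENNReal.ofReal ‖t ⬝ᵥ R *ᵥ star t - R.trace‖ := fun t => by
    rw [rowQuadForm, gramStieltjes, rowGram_erase_update, Function.update_self, ← mul_sub, norm_mul,
      norm_inv, Complex.norm_natCast, ENNReal.ofReal_mul (by positivity)]
  refine (lintegral_congr e).trans_le ?_
  rw [lintegral_const_mul' _ _ ENNReal.ofReal_ne_top]
  refine (mul_le_mul_right (lintegral_norm_quadForm_sub_trace_le (ν i) (hν i) R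
    (inv_nonneg.2 hz.le) hT (mul_pos hn' hβ) (fun j => norm_resolventMatrix_apply_le hH hz j j)
    (fun k => sum_norm_sq_resolventMatrix_col_le hH hz k) (hτ i)) _).trans (le_of_eq ?_)
  rw [← ENNReal.ofReal_mul (by positivity)]
  congr 1
  field_simp

theorem lintegral_mpDefect_le {p n : ℕ} (hn : 0 < n) (hpn : p ≤ n)
    (ν : Fin p → Fin n → Measure ℂ)
    [∀ i j, IsProbabilityMeasure (ν i j)] (hν : ∀ i j, IsStandardized (ν i j)) (y : ℝ) {z : ℂ}
    (hz : 0 < z.im) {T τ β : ℝ} (hT : 0 ≤ T) (hβ : 0 < β) (hτ0 : 0 ≤ τ)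
    (hτ : ∀ i j, tailMoment (ν i j) T ≤ τ) :
    ∫⁻ X, ENNReal.ofReal ‖mpDefect y z (gramStieltjes Finset.univ X z)‖
        ∂Measure.pi (fun i => Measure.pi (ν i))
      ≤ ENNReal.ofReal (‖z‖ / z.im * (β + (z.im⁻¹) ^ 2 * (T + 2) / (2 * β * n) + z.im⁻¹ * (2 * τ)
          + (n : ℝ)⁻¹ * z.im⁻¹) + |(p : ℝ) / n - y| * z.im⁻¹) := by
  have hn' : (0 : ℝ) < n := by exact_mod_cast hn
  have hpn' : (p : ℝ) ≤ n := by exact_mod_cast hpn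
  set Q : ℝ := β + (z.im⁻¹) ^ 2 * (T + 2) / (2 * β * n) + z.im⁻¹ * (2 * τ) with hQ
  have hQ0 : 0 ≤ Q := by positivity
  set π := Measure.pi (fun i => Measure.pi (ν i))
  have hmeas : ∀ i, Measurable fun X : Fin p → Fin n → ℂ =>
      ENNReal.ofReal (‖rowQuadForm X z i - gramStieltjes (Finset.univ.erase i) X z‖
        + (n : ℝ)⁻¹ * z.im⁻¹) := fun i =>
    (((measurable_rowQuadForm z i).sub (measurable_gramStieltjes _ z)).norm.add_const _).ennreal_ofReal
  have hone : ∀ i, ∫⁻ X, ENNReal.ofReal (‖rowQuadForm X z i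
      - gramStieltjes (Finset.univ.erase i) X z‖ + (n : ℝ)⁻¹ * z.im⁻¹) ∂π
      ≤ ENNReal.ofReal (Q + (n : ℝ)⁻¹ * z.im⁻¹) := fun i => by
    rw [ENNReal.ofReal_add hQ0 (by positivity)]
    calc _ = ∫⁻ X, (ENNReal.ofReal ‖rowQuadForm X z i
          - gramStieltjes (Finset.univ.erase i) X z‖ + ENNReal.ofReal ((n : ℝ)⁻¹ * z.im⁻¹)) ∂π :=
        lintegral_congr fun X => ENNReal.ofReal_add (norm_nonneg _) (by positivity)
      _ = _ := lintegral_add_right _ measurable_const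
      _ ≤ _ := by
        simp only [lintegral_const, measure_univ, mul_one]
        gcongr
        exact lintegral_rowQuadForm_sub_le hn ν hν hz hT hβ hτ i
  calc _ ≤ ∫⁻ X, (ENNReal.ofReal (‖z‖ / z.im * (n : ℝ)⁻¹) * ∑ i, ENNReal.ofReal (‖rowQuadForm X z i
          - gramStieltjes (Finset.univ.erase i) X z‖ + (n : ℝ)⁻¹ * z.im⁻¹)
        + ENNReal.ofReal (|(p : ℝ) / n - y| * z.im⁻¹)) ∂π := by
        refine lintegral_mono fun X => ?_
        rw [← ENNReal.ofReal_sum_of_nonneg fun i _ => by positivity,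
          ← ENNReal.ofReal_mul (by positivity), ← ENNReal.ofReal_add (by positivity) (by positivity)]
        refine ENNReal.ofReal_le_ofReal ?_
        rw [mul_assoc]
        exact norm_mpDefect_gramStieltjes_le hn y X hz
    _ = ENNReal.ofReal (‖z‖ / z.im * (n : ℝ)⁻¹) * ∑ i, ∫⁻ X, ENNReal.ofReal (‖rowQuadForm X z i
          - gramStieltjes (Finset.univ.erase i) X z‖ + (n : ℝ)⁻¹ * z.im⁻¹) ∂π
        + ENNReal.ofReal (|(p : ℝ) / n - y| * z.im⁻¹) := by
        rw [lintegral_add_right _ measurable_const, lintegral_const_mul' _ _ ENNReal.ofReal_ne_top,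
          lintegral_finsetSum _ fun i _ => hmeas i]
        simp
    _ ≤ ENNReal.ofReal (‖z‖ / z.im * (n : ℝ)⁻¹) * ∑ _i : Fin p,
          ENNReal.ofReal (Q + (n : ℝ)⁻¹ * z.im⁻¹)
        + ENNReal.ofReal (|(p : ℝ) / n - y| * z.im⁻¹) := by
        gcongr with i
        exact hone i
    _ = ENNReal.ofReal (‖z‖ / z.im * (n : ℝ)⁻¹ * (p * (Q + (n : ℝ)⁻¹ * z.im⁻¹))
        + |(p : ℝ) / n - y| * z.im⁻¹) := by
        rw [Finset.sum_const, Finset.card_univ, Fintype.card_fin, nsmul_eq_mul,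
          ← ENNReal.ofReal_natCast p, ← ENNReal.ofReal_mul (Nat.cast_nonneg p),
          ← ENNReal.ofReal_mul (by positivity), ← ENNReal.ofReal_add (by positivity) (by positivity)]
    _ ≤ _ := by
        refine ENNReal.ofReal_le_ofReal ?_
        gcongr ?_ + _
        rw [mul_assoc]
        gcongr
        rw [← mul_assoc]
        refine mul_le_of_le_one_left (by positivity) ?_
        rw [inv_mul_le_one₀ hn']
        exact hpn'

/-- The Stieltjes transform satisfies the Marchenko–Pastur equation up to a small error,
with exponentially high probability. -/
theorem exists_measure_lt_mpDefect_le_exp {y : ℝ} (hy0 : 0 ≤ y) (hy1 : y ≤ 1) {p : ℕ → ℕ}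
    (hpn : ∀ n, p n ≤ n) (hp : Tendsto (fun n : ℕ => (p n : ℝ) / n) atTop (nhds y))
    (ν : ∀ n, Fin (p n) → Fin n → Measure ℂ) [∀ n i j, IsProbabilityMeasure (ν n i j)]
    (hν : ∀ n i j, IsStandardized (ν n i j))
    (hL : ∀ κ > 0, ∀ τ > 0, ∀ᶠ n : ℕ in atTop, ∀ i j, tailMoment (ν n i j) (κ * n) ≤ τ)
    {z : ℂ} (hz : 0 < z.im) {δ : ℝ} (hδ : 0 < δ) :
    ∃ c : ℝ, 0 < c ∧ ∀ᶠ n : ℕ in atTop,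
      Measure.pi (fun i => Measure.pi (ν n i))
          {X | δ < ‖mpDefect y z (gramStieltjes Finset.univ X z)‖}
        ≤ ENNReal.ofReal (Real.exp (-(c * n))) := by
  set G : ℝ := ‖z‖ / z.im with hG
  have hzn : 0 < ‖z‖ := hz.trans_le (Complex.im_le_norm z)
  have hG0 : 0 < G := by positivity
  obtain ⟨B, hB⟩ : ∃ B : ℝ, B = z.im⁻¹ := ⟨_, rfl⟩
  have hB0 : 0 < B := by rw [hB]; positivity
  -- β, κ and τ make each of the three terms that do not vanish with n equal to δ/16; the remaining
  -- terms are eventually below δ/4, so the mean defect is below δ/2.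
  set β : ℝ := δ / (16 * G) with hβ
  have hβ0 : 0 < β := by positivity
  set κ : ℝ := δ * β / (8 * G * B ^ 2) with hκ
  have hκ0 : 0 < κ := by positivity
  set τ : ℝ := δ / (32 * G * B) with hτ
  have hτ0 : 0 < τ := by positivity
  set C : ℝ := (‖z‖ * (2 * B) + (‖z‖ + 1)) * (2 * B) with hC
  have hC0 : 0 < C := by positivity
  refine ⟨δ ^ 2 / (8 * C ^ 2), by positivity, ?_⟩
  have hlim : Tendsto (fun n : ℕ => G * (B ^ 2 / β + B) * (n : ℝ)⁻¹ + |(p n : ℝ) / n - y| * B)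
      atTop (nhds 0) := by
    have h1 : Tendsto (fun n : ℕ => (n : ℝ)⁻¹) atTop (nhds 0) := tendsto_inv_atTop_nhds_zero_nat
    have h2 : Tendsto (fun n : ℕ => |(p n : ℝ) / n - y|) atTop (nhds 0) := by
      have := (hp.sub_const y).abs
      simpa using this
    simpa using (h1.const_mul (G * (B ^ 2 / β + B))).add (h2.mul_const B)
  filter_upwards [hL κ hκ0 τ hτ0, hlim.eventually_lt_const (show (0 : ℝ) < δ / 4 by positivity),
    eventually_gt_atTop 0] with n hLn hlimn hn
  have hn' : (0 : ℝ) < n := by exact_mod_cast hn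
  set π := Measure.pi (fun i => Measure.pi (ν n i)) with hπ
  set f : (Fin (p n) → Fin n → ℂ) → ℝ := fun X => ‖mpDefect y z (gramStieltjes Finset.univ X z)‖
    with hf
  have hfm : Measurable f := ((measurable_mpDefect y z).comp (measurable_gramStieltjes _ z)).norm
  have hm : ∀ X : Fin (p n) → Fin n → ℂ, ‖gramStieltjes Finset.univ X z‖ ≤ B := fun X =>
    hB ▸ norm_gramStieltjes_le _ X hz
  have hfb : ∀ X, |f X| ≤ (‖z‖ * (2 * B) + (‖z‖ + 1)) * B + 1 := fun X => by
    rw [abs_of_nonneg (norm_nonneg _)]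
    have h1 := norm_mpDefect_sub_le hy0 hy1 z (hm X) (m' := 0) (b := B) (by simpa using hB0.le)
    have h2 : mpDefect y z 0 = 1 := by simp [mpDefect]
    rw [h2, sub_zero] at h1
    have h3 := norm_le_norm_sub_add (mpDefect y z (gramStieltjes Finset.univ X z)) 1
    rw [norm_one] at h3
    refine h3.trans (add_le_add_left (h1.trans ?_) _)
    gcongr
    exact hm X
  have hfc : ∀ X i t, |f (Function.update X i t) - f X| ≤ C * (n : ℝ)⁻¹ := fun X i t => by
    refine (abs_norm_sub_norm_le _ _).trans ?_
    refine (norm_mpDefect_sub_le hy0 hy1 z (hm _) (hm _)).trans ?_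
    rw [hC, mul_assoc]
    gcongr
    refine (norm_gramStieltjes_update_sub_le X hz i t).trans (le_of_eq ?_)
    rw [← hB]; ring
  have hmean : ∫ X, f X ∂π ≤ δ / 2 := by
    have h1 := lintegral_mpDefect_le hn (hpn n) (ν n) (hν n) y hz (T := κ * n) (by positivity) hβ0
      hτ0.le hLn
    have hfi : Integrable f π := Integrable.of_bound hfm.aestronglyMeasurable _ (.of_forall hfb)
    rw [← ofReal_integral_eq_lintegral_ofReal hfi (.of_forall fun X => norm_nonneg _),
      ENNReal.ofReal_le_ofReal_iff (by positivity), ← hB, ← hG] at h1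
    refine h1.trans ?_
    have e : G * (β + B ^ 2 * (κ * n + 2) / (2 * β * n) + B * (2 * τ) + (n : ℝ)⁻¹ * B)
        + |(p n : ℝ) / n - y| * B
        = G * β + G * B ^ 2 * κ / (2 * β) + 2 * G * B * τ
          + (G * (B ^ 2 / β + B) * (n : ℝ)⁻¹ + |(p n : ℝ) / n - y| * B) := by
      field_simp
      ring
    rw [e]
    have e1 : G * β = δ / 16 := by rw [hβ]; field_simp
    have e2 : G * B ^ 2 * κ / (2 * β) = δ / 16 := by rw [hκ]; field_simp; norm_num
    have e3 : 2 * G * B * τ = δ / 16 := by rw [hτ]; field_simp; norm_num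
    rw [e1, e2, e3]
    linarith
  -- This s minimises -sδ/2 + n(sC/n)²/2, the exponent for n rows with differences C/n.
  have htail := measure_integral_add_le_le_exp (fun i => Measure.pi (ν n i)) hfm hfb hfc
    (s := δ / (2 * C ^ 2) * n) (by positivity) (δ / 2)
  refine (measure_mono fun X hX => ?_).trans (htail.trans (ENNReal.ofReal_le_ofReal ?_))
  · simp only [Set.mem_ofPred_eq] at hX ⊢
    linarith
  · rw [Real.exp_le_exp]
    have hpn' : (p n : ℝ) ≤ n := by exact_mod_cast hpn n
    have e1 : (δ / (2 * C ^ 2) * n * (C * (n : ℝ)⁻¹)) ^ 2 / 2 = δ ^ 2 / (8 * C ^ 2) := by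
      field_simp; norm_num
    have e2 : δ / (2 * C ^ 2) * n * (δ / 2) = 2 * (δ ^ 2 / (8 * C ^ 2)) * n := by
      field_simp; norm_num
    rw [e1, e2]
    have := mul_le_mul_of_nonneg_right hpn' (show 0 ≤ δ ^ 2 / (8 * C ^ 2) by positivity)
    linarith

end GramConcentration

/-! ### Laws of the entries and the Lindeberg condition -/

section Laws

theorem isStandardized_map {Ω : Type*} [MeasurableSpace Ω] {μ : Measure Ω} {X : Ω → ℂ}
    (hX : Measurable X) (h0 : ∫ ω, X ω ∂μ = 0) (h1 : ∫ ω, ‖X ω‖ ^ 2 ∂μ = 1) :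
    IsStandardized (μ.map X) where
  memLp := by
    rw [memLp_map_measure_iff aestronglyMeasurable_id hX.aemeasurable]
    refine (memLp_two_iff_integrable_sq_norm hX.aestronglyMeasurable).2 ?_
    -- A non-integrable function has Bochner integral 0, so variance 1 forces square integrability.
    exact Integrable.of_integral_ne_zero (by rw [h1]; exact one_ne_zero)
  integral_eq_zero := by
    rw [integral_map hX.aemeasurable (by fun_prop), h0]
  integral_norm_sq := by
    rw [integral_map hX.aemeasurable (by fun_prop), h1]

theorem tailMoment_map {Ω : Type*} [MeasurableSpace Ω] {μ : Measure Ω} {X : Ω → ℂ}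
    (hX : Measurable X) (T : ℝ) :
    tailMoment (μ.map X) T = ∫ ω, (if T < ‖X ω‖ ^ 2 then ‖X ω‖ ^ 2 else 0) ∂μ := by
  rw [tailMoment, integral_map hX.aemeasurable]
  have hset : MeasurableSet {x : ℂ | T < ‖x‖ ^ 2} :=
    measurableSet_lt measurable_const (by fun_prop)
  exact (Measurable.ite hset (by fun_prop) measurable_const).aestronglyMeasurable

theorem tailMoment_map_eq_zero {Ω : Type*} [MeasurableSpace Ω] {μ : Measure Ω} {X : Ω → ℂ}
    (hX : Measurable X) {T K : ℝ} (hK : ∀ᵐ ω ∂μ, ‖X ω‖ ≤ K) (hT : K ^ 2 ≤ T) :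
    tailMoment (μ.map X) T = 0 := by
  rw [tailMoment_map hX]
  refine integral_eq_zero_of_ae ?_
  filter_upwards [hK] with ω hω
  rw [if_neg]
  · rfl
  · have : ‖X ω‖ ^ 2 ≤ K ^ 2 := by gcongr
    linarith

/-- On {|X|² > T} one has |X|² ≤ |X|^C₀ · T^(-(C₀-2)/2), since the excess factor |X|^(C₀-2) is at
least T^((C₀-2)/2). -/
theorem tailMoment_map_le {Ω : Type*} [MeasurableSpace Ω] {μ : Measure Ω} {X : Ω → ℂ}
    (hX : Measurable X) {T C₀ C : ℝ} (hT : 0 < T) (hC₀ : 2 ≤ C₀)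
    (hi : Integrable (fun ω => ‖X ω‖ ^ C₀) μ) (hC : ∫ ω, ‖X ω‖ ^ C₀ ∂μ ≤ C) :
    tailMoment (μ.map X) T ≤ C * T ^ (-((C₀ - 2) / 2)) := by
  rw [tailMoment_map hX]
  calc _ ≤ ∫ ω, ‖X ω‖ ^ C₀ * T ^ (-((C₀ - 2) / 2)) ∂μ := by
        refine integral_mono_of_nonneg (.of_forall fun ω => ?_) (hi.mul_const _)
          (.of_forall fun ω => ?_)
        · simp only [Pi.zero_apply]; split_ifs <;> positivity
        · simp only
          split_ifs with h
          · have hx : 0 < ‖X ω‖ := by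
              by_contra! hcon
              have : ‖X ω‖ = 0 := le_antisymm hcon (norm_nonneg _)
              rw [this] at h
              norm_num at h
              linarith
            have h1 : T ^ ((C₀ - 2) / 2) ≤ ‖X ω‖ ^ (C₀ - 2) := by
              calc T ^ ((C₀ - 2) / 2) ≤ (‖X ω‖ ^ 2) ^ ((C₀ - 2) / 2) := by
                    gcongr
                _ = ‖X ω‖ ^ (C₀ - 2) := by
                    rw [← Real.rpow_natCast, ← Real.rpow_mul hx.le]
                    congr 1
                    push_cast
                    ring
            have h2 : ‖X ω‖ ^ C₀ = ‖X ω‖ ^ 2 * ‖X ω‖ ^ (C₀ - 2) := by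
              rw [← Real.rpow_natCast, ← Real.rpow_add hx]
              congr 1
              push_cast
              ring
            rw [Real.rpow_neg hT.le, ← div_eq_mul_inv, le_div_iff₀ (by positivity), h2]
            gcongr
          · positivity
    _ = (∫ ω, ‖X ω‖ ^ C₀ ∂μ) * T ^ (-((C₀ - 2) / 2)) := integral_mul_const _ _
    _ ≤ _ := by gcongr

theorem map_eq_pi_pi {Ω : Type*} [MeasurableSpace Ω] (μ : Measure Ω) [IsProbabilityMeasure μ]
    {p n : ℕ} {M : Ω → Matrix (Fin p) (Fin n) ℂ} (hm : ∀ i j, Measurable fun ω => M ω i j)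
    (hind : iIndepFun (fun (ij : Fin p × Fin n) ω => M ω ij.1 ij.2) μ) :
    μ.map (fun ω i j => M ω i j)
      = Measure.pi fun i => Measure.pi fun j => μ.map fun ω => M ω i j := by
  have : ∀ i j, IsProbabilityMeasure (μ.map fun ω => M ω i j) := fun i j =>
    Measure.isProbabilityMeasure_map (hm i j).aemeasurable
  have h1 := (iIndepFun_iff_map_fun_eq_pi_map fun ij : Fin p × Fin n =>
    (hm ij.1 ij.2).aemeasurable).1 hind
  have h2 := Measure.infinitePi_map_curry fun (i : Fin p) (j : Fin n) => μ.map fun ω => M ω i j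
  simp only [Measure.infinitePi_eq_pi] at h2
  rw [← h2, ← h1]
  exact (Measure.map_map (MeasurableEquiv.measurable (MeasurableEquiv.curry (Fin p) (Fin n) ℂ))
    (measurable_pi_lambda _ fun ij : Fin p × Fin n => hm ij.1 ij.2)).symm

/-- The Lindeberg condition at scale κn. If C₀ > 2, the moment bound makes the tail
O(n^(-(C₀-2)/2)). If C₀ = 2, the growth condition gives K² ≤ κn eventually, since the logarithmic
factor outgrows c/κ, and the tail vanishes. -/
theorem eventually_tailMoment_le {Ω : ℕ → Type*} [∀ n, MeasurableSpace (Ω n)]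
    (μ : ∀ n, Measure (Ω n)) [∀ n, IsProbabilityMeasure (μ n)] {p : ℕ → ℕ}
    {M : ∀ n, Ω n → Matrix (Fin (p n)) (Fin n) ℂ} {C₀ : ℝ} (h : ConditionC1 μ M C₀)
    {K : ℕ → ℝ} (hK : ∀ n i j, ∀ᵐ ω ∂(μ n), ‖M n ω i j‖ ≤ K n)
    (hK2 : C₀ = 2 →
      (fun n : ℕ => K n ^ 2 * Real.log n ^ 20) =O[atTop] (fun n : ℕ => (n : ℝ)))
    {κ τ : ℝ} (hκ : 0 < κ) (hτ : 0 < τ) :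
    ∀ᶠ n : ℕ in atTop, ∀ i j, tailMoment ((μ n).map fun ω => M n ω i j) (κ * n) ≤ τ := by
  obtain ⟨hC₀, hm, -, -, -, C, hC⟩ := h
  rcases hC₀.eq_or_lt with h2 | h2
  · obtain ⟨c, hc0, hc⟩ := (hK2 h2.symm).exists_pos
    have hlog : Tendsto (fun n : ℕ => Real.log n ^ 20) atTop atTop :=
      (tendsto_pow_atTop (by norm_num)).comp
        (Real.tendsto_log_atTop.comp tendsto_natCast_atTop_atTop)
    filter_upwards [hc.bound, hlog.eventually_ge_atTop (c / κ)] with n hn hlogn i j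
    rw [tailMoment_map_eq_zero (hm n i j) (hK n i j)]
    · exact hτ.le
    have hlog0 : 0 < Real.log n ^ 20 := lt_of_lt_of_le (by positivity) hlogn
    rw [Real.norm_eq_abs, abs_of_nonneg (by positivity), Real.norm_eq_abs, Nat.abs_cast] at hn
    rw [div_le_iff₀ hκ] at hlogn
    have : K n ^ 2 * Real.log n ^ 20 ≤ κ * n * Real.log n ^ 20 := by
      refine hn.trans ?_
      calc c * (n : ℝ) ≤ Real.log n ^ 20 * κ * n := by gcongr
        _ = _ := by ring
    exact le_of_mul_le_mul_right this hlog0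
  · have hlim : Tendsto (fun n : ℕ => C * (κ * (n : ℝ)) ^ (-((C₀ - 2) / 2))) atTop (nhds 0) := by
      have h3 : Tendsto (fun n : ℕ => κ * (n : ℝ)) atTop atTop :=
        tendsto_natCast_atTop_atTop.const_mul_atTop hκ
      have h4 := (tendsto_rpow_neg_atTop (show 0 < (C₀ - 2) / 2 by linarith)).comp h3
      simpa using h4.const_mul C
    filter_upwards [hlim.eventually_lt_const hτ, eventually_gt_atTop 0] with n hn hn0 i j
    have hn' : (0 : ℝ) < n := by exact_mod_cast hn0
    exact (tailMoment_map_le (hm n i j) (by positivity) hC₀ (hC n i j).1 (hC n i j).2).trans hn.le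

end Laws

/-! ### From counts to ordered eigenvalues -/

section Counting

open scoped ComplexOrder in
theorem covarianceMatrix_eigenvalues₀_nonneg {p n : ℕ} (M : Matrix (Fin p) (Fin n) ℂ)
    (i : Fin (Fintype.card (Fin n))) : 0 ≤ (covarianceMatrix_isHermitian M).eigenvalues₀ i := by
  have h : (covarianceMatrix M).PosSemidef := by
    rw [covarianceMatrix_eq_rowGram]; exact rowGram_posSemidef _ _
  have := h.eigenvalues_nonneg (Fintype.equivOfCardEq (Fintype.card_fin _) i)
  simpa [Matrix.IsHermitian.eigenvalues] using this

/-- The eigenvalues of the covariance matrix, in decreasing order. -/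
noncomputable def covSpectrum {p n : ℕ} (M : Matrix (Fin p) (Fin n) ℂ) (i : Fin n) : ℝ :=
  (covarianceMatrix_isHermitian M).eigenvalues₀ (Fin.cast (Fintype.card_fin n).symm i)

theorem covSpectrum_antitone {p n : ℕ} (M : Matrix (Fin p) (Fin n) ℂ) :
    Antitone (covSpectrum M) := fun _ _ h =>
  (covarianceMatrix_isHermitian M).eigenvalues₀_antitone h

theorem covEigenvalue_eq_covSpectrum {p n : ℕ} (h : p ≤ n) (M : Matrix (Fin p) (Fin n) ℂ)
    (i : Fin p) : covEigenvalue h M i = covSpectrum M (Fin.castLE h i.rev) := rfl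

/-- Few eigenvalues above `t` keep `λᵢ` below `t`. -/
theorem covEigenvalue_le_of_card {p n : ℕ} (h : p ≤ n) (M : Matrix (Fin p) (Fin n) ℂ)
    {t c : ℝ} (hc : ∀ s : Finset (Fin n), (∀ i ∈ s, covSpectrum M i ∈ Set.Ioi t) → (s.card : ℝ) ≤ c)
    (i : Fin p) (hi : c < p - (i : ℝ)) : covEigenvalue h M i ≤ t := by
  rw [covEigenvalue_eq_covSpectrum]
  by_contra! hcon
  have := hc (Finset.Iic (Fin.castLE h i.rev)) fun j hj =>
    hcon.trans_le (covSpectrum_antitone M (Finset.mem_Iic.1 hj))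
  rw [Fin.card_Iic] at this
  -- In decreasing order λᵢ₊₁ has zero-based position p - 1 - i, so p - i eigenvalues are at least
  -- as large.
  have e : ((Fin.castLE h i.rev : Fin n) : ℕ) + 1 = p - i := by
    simp [Fin.val_rev]; omega
  rw [e, Nat.cast_sub i.2.le] at this
  linarith

/-- Few eigenvalues below `t` keep `λᵢ` above `t`. -/
theorem le_covEigenvalue_of_card {p n : ℕ} (h : p ≤ n) (M : Matrix (Fin p) (Fin n) ℂ)
    {t c : ℝ} (hc : ∀ s : Finset (Fin n), (∀ i ∈ s, covSpectrum M i ∈ Set.Iio t) → (s.card : ℝ) ≤ c)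
    (i : Fin p) (hi : c < n - p + ((i : ℝ) + 1)) : t ≤ covEigenvalue h M i := by
  rw [covEigenvalue_eq_covSpectrum]
  by_contra! hcon
  have := hc (Finset.Ici (Fin.castLE h i.rev)) fun j hj =>
    (covSpectrum_antitone M (Finset.mem_Ici.1 hj)).trans_lt hcon
  rw [Fin.card_Ici] at this
  -- From that position to the end there are i + 1 retained eigenvalues and the n - p discarded
  -- ones.
  have e : n - ((Fin.castLE h i.rev : Fin n) : ℕ) = (n - p) + (i + 1) := by
    simp [Fin.val_rev]; omega
  rw [e] at this
  push_cast [Nat.cast_sub h] at this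
  linarith

end Counting

/-! ### Union bound and conclusion -/

theorem exp_neg_mul_eventually_le_rpow {c : ℝ} (hc : 0 < c) (A : ℝ) :
    ∀ᶠ n : ℕ in atTop, Real.exp (-(c * n)) ≤ (n : ℝ) ^ (-A) := by
  have h := ((isLittleO_exp_neg_mul_rpow_atTop hc (-A)).comp_tendsto
    tendsto_natCast_atTop_atTop).bound one_pos
  filter_upwards [h] with n hn
  simpa [abs_of_nonneg (Real.rpow_nonneg (Nat.cast_nonneg n) _)] using hn

/-- The good event and the finitely many bad ones cover the space, so subadditivity alone gives the
lower bound and no event has to be measurable. -/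
theorem withOverwhelmingProbability_of_forall_finset {Ω : ℕ → Type*}
    [∀ n, MeasurableSpace (Ω n)] (μ : ∀ n, Measure (Ω n)) [∀ n, IsProbabilityMeasure (μ n)]
    {ι : Type*} (Z : Finset ι) (F : ι → ∀ n, Set (Ω n)) {E : ∀ n, Set (Ω n)}
    (hE : ∀ᶠ n in atTop, ∀ ω, (∀ q ∈ Z, ω ∉ F q n) → ω ∈ E n)
    (hF : ∀ q ∈ Z, ∃ c : ℝ, 0 < c ∧ ∀ᶠ n : ℕ in atTop,
      μ n (F q n) ≤ ENNReal.ofReal (Real.exp (-(c * n)))) :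
    WithOverwhelmingProbability μ E := by
  intro A _
  refine ⟨Z.card, ?_⟩
  have h : ∀ᶠ n : ℕ in atTop, ∀ q ∈ Z, μ n (F q n) ≤ ENNReal.ofReal ((n : ℝ) ^ (-A)) := by
    rw [eventually_all_finset]
    intro q hq
    obtain ⟨c, hc, h⟩ := hF q hq
    filter_upwards [h, exp_neg_mul_eventually_le_rpow hc A] with n h1 h2
    exact h1.trans (ENNReal.ofReal_le_ofReal h2)
  filter_upwards [h, hE] with n hn hEn
  have hcov : (Set.univ : Set (Ω n)) ⊆ E n ∪ ⋃ q ∈ Z, F q n := fun ω _ => by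
    by_cases hω : ∀ q ∈ Z, ω ∉ F q n
    · exact .inl (hEn ω hω)
    · push Not at hω
      obtain ⟨q, hq, hω⟩ := hω
      exact .inr (Set.mem_biUnion hq hω)
  have h1 : (1 : ℝ) ≤ (μ n).real (E n) + ∑ q ∈ Z, (μ n).real (F q n) := by
    calc (1 : ℝ) = (μ n).real Set.univ := by simp
      _ ≤ (μ n).real (E n ∪ ⋃ q ∈ Z, F q n) := measureReal_mono hcov
      _ ≤ (μ n).real (E n) + (μ n).real (⋃ q ∈ Z, F q n) := measureReal_union_le _ _
      _ ≤ _ := by gcongr; exact measureReal_biUnion_finset_le _ _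
  have h2 : ∑ q ∈ Z, (μ n).real (F q n) ≤ Z.card * (n : ℝ) ^ (-A) := by
    rw [← nsmul_eq_mul]
    refine Finset.sum_le_card_nsmul _ _ _ fun q hq => ?_
    exact ENNReal.toReal_le_of_le_ofReal (by positivity) (hn q hq)
  linarith

theorem corollary3p3 (y : ℝ) (hy0 : 0 < y) (hy1 : y ≤ 1) (ε : ℝ) (hε : 0 < ε) :
    ∃ ε' : ℝ, 0 < ε' ∧
      ∀ (Ω : ℕ → Type*) [∀ n, MeasurableSpace (Ω n)] (μ : ∀ n, Measure (Ω n))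
        [∀ n, IsProbabilityMeasure (μ n)] (p : ℕ → ℕ) (hpn : ∀ n, p n ≤ n)
        (_ : Tendsto (fun n : ℕ => (p n : ℝ) / n) atTop (nhds y))
        (M : ∀ n, Ω n → Matrix (Fin (p n)) (Fin n) ℂ) (C₀ : ℝ) (_ : ConditionC1 μ M C₀)
        (K : ℕ → ℝ) (_ : ∀ n, 1 < K n)
        (_ : ∀ n i j, ∀ᵐ ω ∂(μ n), ‖M n ω i j‖ ≤ K n)
        (_ : C₀ = 2 →
          (fun n : ℕ => K n ^ 2 * Real.log n ^ 20) =O[atTop] (fun n : ℕ => (n : ℝ)))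
        (_ : ContinuousLaw μ M),
        WithOverwhelmingProbability μ fun n => {ω | ∀ i : Fin (p n),
          ε * p n ≤ (i : ℝ) + 1 → (i : ℝ) + 1 ≤ (1 - ε) * p n →
            (1 - √y) ^ 2 + ε' ≤ covEigenvalue (hpn n) (M n ω) i ∧
              covEigenvalue (hpn n) (M n ω) i ≤ (1 + √y) ^ 2 - ε'} := by
  -- For the upper edge, at least εp ≈ εyn > dn eigenvalues are no smaller than λᵢ. For the lower
  -- edge, (1-y+d/2)n must stay below n - (1-ε)p; as (1-ε)p/n < (1-ε)y + d/2 eventually, d < εy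
  -- suffices.
  obtain ⟨d, hd0, hd⟩ : ∃ d : ℝ, 0 < d ∧ 2 * d < ε * y :=
    ⟨ε * y / 3, by positivity, by linarith [mul_pos hε hy0]⟩
  obtain ⟨ε₁, hε₁, Z₁, hZ₁, hl⟩ := massBound_lower hy0 hy1 (d := d / 2) (by positivity)
  obtain ⟨ε₂, hε₂, Z₂, hZ₂, hu⟩ := massBound_upper hy0 hy1 (d := d) hd0
  refine ⟨min ε₁ ε₂, lt_min hε₁ hε₂, ?_⟩
  intro Ω _ μ _ p hpn hp M C₀ hC1 K _ hK hK2 _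
  classical
  have hprob : ∀ n i j, IsProbabilityMeasure ((μ n).map fun ω => M n ω i j) := fun n i j =>
    Measure.isProbabilityMeasure_map (hC1.2.1 n i j).aemeasurable
  have hmeas : ∀ n, Measurable fun ω i j => M n ω i j := fun n =>
    measurable_pi_lambda _ fun i => measurable_pi_lambda _ fun j => hC1.2.1 n i j
  refine withOverwhelmingProbability_of_forall_finset μ (Z₁ ∪ Z₂)
    (fun q n => {ω | q.2 < ‖mpDefect y q.1 (gramStieltjes Finset.univ (M n ω) q.1)‖}) ?_ ?_
  · have hlim1 : ∀ᶠ n : ℕ in atTop, ε * ((p n : ℝ) / n) > d :=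
      (hp.const_mul ε).eventually_const_lt (by linarith)
    have hlim2 : ∀ᶠ n : ℕ in atTop, (1 - ε) * ((p n : ℝ) / n) < (1 - ε) * y + d / 2 :=
      (hp.const_mul (1 - ε)).eventually_lt_const (by linarith)
    filter_upwards [hlim1, hlim2, eventually_gt_atTop 0] with n h1 h2 hn ω hω i hi1 hi2
    have hn' : (0 : ℝ) < n := by exact_mod_cast hn
    rw [gt_iff_lt, ← mul_div_assoc, lt_div_iff₀ hn'] at h1
    rw [← mul_div_assoc, div_lt_iff₀ hn'] at h2
    have hgood : ∀ q ∈ Z₁ ∪ Z₂, 0 < q.1.im →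
        ‖mpDefect y q.1 (empStieltjes (covSpectrum (M n ω)) q.1)‖ ≤ q.2 := fun q hq hq0 => by
      have := hω q hq
      rw [not_lt, gramStieltjes_eq_empStieltjes _ hq0.ne'] at this
      exact this
    have hnn : ∀ i, 0 ≤ covSpectrum (M n ω) i := fun i =>
      covarianceMatrix_eigenvalues₀_nonneg _ _
    have hL := hl n (covSpectrum (M n ω)) hn hnn fun q hq =>
      hgood q (Finset.mem_union_left _ hq) (hZ₁ q hq).1
    have hU := hu n (covSpectrum (M n ω)) hn hnn fun q hq =>
      hgood q (Finset.mem_union_right _ hq) (hZ₂ q hq).1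
    constructor
    · refine le_trans (by gcongr; exact min_le_left _ _)
        (le_covEigenvalue_of_card (hpn n) (M n ω) hL i ?_)
      nlinarith
    · refine (covEigenvalue_le_of_card (hpn n) (M n ω) hU i ?_).trans
        (by gcongr; exact min_le_right _ _)
      linarith
  · intro q hq
    have hq0 : 0 < q.1.im ∧ 0 < q.2 := (Finset.mem_union.1 hq).elim (hZ₁ q) (hZ₂ q)
    obtain ⟨c, hc, h⟩ := exists_measure_lt_mpDefect_le_exp hy0.le hy1 hpn hp
      (fun n i j => (μ n).map fun ω => M n ω i j)
      (fun n i j => isStandardized_map (hC1.2.1 n i j) (hC1.2.2.2.1 n i j) (hC1.2.2.2.2.1 n i j))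
      (fun κ hκ τ hτ => eventually_tailMoment_le μ hC1 hK hK2 hκ hτ) hq0.1 hq0.2
    refine ⟨c, hc, ?_⟩
    filter_upwards [h] with n hn
    rw [← map_eq_pi_pi (μ n) (hC1.2.1 n) (hC1.2.2.1 n)] at hn
    -- An inequality between the preimage and the image measure is enough to transfer the bound from
    -- the product law.
    exact (Measure.le_map_apply (hmeas n).aemeasurable _).trans hn
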